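/- Let $M(v)=(2\pi)^{-1/2}e^{-v^2/2}$, $\Omega=[0,1]\times\mathbb R$, $\|g\|_V^2=\|g\|_{L^2(\Omega)}^2+\|\partial_x g\|_{L^2(\Omega)}^2$ and $\lambda=\tfrac14$. Let $0<C_s\le 1$ be a constant such that $\|\partial_x s\|_{L^2}^2\ge \tfrac{C_s}{2}\big(\|s-\int_0^1 s\|_{L^2}^2+\|\partial_x s\|_{L^2}^2\big)$ for all $s\in H^1(0,1)$. Let $E:[0,\infty)\times[0,1]\to\mathbb R$ be continuous, with $E(t,\cdot)\in C^3([0,1])$ for every $t\ge 0$, and let $C_E$ be a constant such that for all $t\ge0$ $$\|E(t,\cdot)\|_{L^\infty},\ \|\partial_xE(t,\cdot)\|_{L^\infty},\ \|\partial_x^3E(t,\cdot)\|_{L^\infty}\ \le\ \frac{C_E}{2}\ \le\ \frac{\lambda C_s}{16},\qquad E(t,0)=E(t,1)=0,\quad \partial_x^2E(t,0)=\partial_x^2E(t,1).$$ Consider the Vlasov–Fokker–Planck equation $$\varepsilon\,\partial_t f+v\,\partial_x f-E\,\partial_v f=\tfrac1\varepsilon\,\partial_v\big(M\,\partial_v(f/M)\big)$$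 in the limit case $\varepsilon=0$, that is, its formal hydrodynamic limit, with the feedback matrix $K=\begin{pmatrix}0&1\\1&0\end{pmatrix}$ (periodic boundary conditions). A weak solution in this case is an $f\in C^0([0,\infty);H^1_{x,v}(\Omega))$ of the form $f(t,x,v)=\sigma(t,x)M(v)$, $\sigma=\int_{\mathbb R}f\,dv$, with $f(t,0,v)=f(t,1,v)$ for all $t\ge0$ in the sense of traces, whose density $\sigma$ is a weak solution of $$\partial_t\sigma-\partial_x(\partial_x\sigma+E\sigma)=0\quad\text{on }(0,\infty)\times(0,1),\qquad \partial_x\sigma(t,0)=\partial_x\sigma(t,1),$$ the last condition being understood through the weak form, with test functions $\varphi$ such that $\varphi(t,0)=\varphi(t,1)$. Let $f$ be such a solution with $\int_\Omega f(0,x,v)\,dx\,dv=0$, and let $a$ satisfy $$\frac{4C_E}{3C_s-2C_E}<a<\frac{\lambda-C_E}{4}.$$ Then, with $$\xi=\frac{a(3C_s-2C_E)-4C_E}{8}>0,$$ one has for all $t\ge 0$ $$\Big\|\frac{f(t)}{\sqrt M}\Big\|_V^2\ \le\ \frac54\,\Big\|\frac{f(0)}{\sqrt M}\Big\|_V^2\,e^{-2\xi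 t}.$$ -/

import Mathlib

open MeasureTheory Set Filter Topology
open scoped ENNReal ContDiff

namespace VFP

noncomputable section

/-- The interior of the phase space `[0,1] × ℝ`; points are pairs `(x, v)`. -/
def phase : Set (ℝ × ℝ) := Ioo (0 : ℝ) 1 ×ˢ univ

/-- The global Maxwellian `M(v) = (2π)^{-1/2} exp(-v²/2)`. -/
def maxwellian (v : ℝ) : ℝ := (Real.sqrt (2 * Real.pi))⁻¹ * Real.exp (-(v ^ 2) / 2)

/-- `g'` is the weak (distributional) derivative of `g` in the direction `e` on the phase space;
`e = (1, 0)` is `∂ₓ` and `e = (0, 1)` is `∂ᵥ`. -/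
def HasWeakPartial (e : ℝ × ℝ) (g g' : ℝ × ℝ → ℝ) : Prop :=
  LocallyIntegrableOn g phase ∧ LocallyIntegrableOn g' phase ∧
    ∀ φ : ℝ × ℝ → ℝ, ContDiff ℝ ∞ φ → HasCompactSupport φ → tsupport φ ⊆ phase →
      ∫ p in phase, g p * fderiv ℝ φ p e = - ∫ p in phase, g' p * φ p

/-- `‖g‖_V² = ‖g‖² + ‖∂ₓ g‖²` (norms of `L²` on the phase space). The weak derivative is unique
up to null sets, so the infimum is over a single value; it is `⊤` if there is no weak derivative. -/
def vNormSq (g : ℝ × ℝ → ℝ) : ℝ≥0∞ :=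
  ⨅ (gx : ℝ × ℝ → ℝ) (_ : HasWeakPartial (1, 0) g gx),
    (∫⁻ p in phase, ‖g p‖ₑ ^ 2) + ∫⁻ p in phase, ‖gx p‖ₑ ^ 2

/-- The squared norm `‖g‖² + ‖∂ₓ g‖² + ‖∂ᵥ g‖²` of `H¹_{x,v}`, with value `⊤` outside this space. -/
def h1NormSq (g : ℝ × ℝ → ℝ) : ℝ≥0∞ :=
  ⨅ (gx : ℝ × ℝ → ℝ) (gv : ℝ × ℝ → ℝ)
    (_ : HasWeakPartial (1, 0) g gx) (_ : HasWeakPartial (0, 1) g gv),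
    (∫⁻ p in phase, ‖g p‖ₑ ^ 2) + (∫⁻ p in phase, ‖gx p‖ₑ ^ 2) + ∫⁻ p in phase, ‖gv p‖ₑ ^ 2

/-- `f ∈ C⁰([0,∞); H¹_{x,v})`. -/
def ContinuousInH1 (f : ℝ → ℝ × ℝ → ℝ) : Prop :=
  (∀ t, 0 ≤ t → h1NormSq (f t) < ⊤) ∧
    ∀ t₀, 0 ≤ t₀ →
      Tendsto (fun t => h1NormSq (fun p => f t p - f t₀ p)) (𝓝[Ici 0] t₀) (𝓝 0)

/-- `γ₀` and `γ₁` are the traces `g(0,·)` and `g(1,·)` of a function `g ∈ L²` with `∂ₓ g ∈ L²`: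
they are characterised by Green's formula against test functions that need not vanish at
`x = 0, 1`. -/
def IsBoundaryTrace (g : ℝ × ℝ → ℝ) (γ₀ γ₁ : ℝ → ℝ) : Prop :=
  LocallyIntegrable γ₀ ∧ LocallyIntegrable γ₁ ∧ MemLp g 2 (volume.restrict phase) ∧
    ∃ gx : ℝ × ℝ → ℝ, HasWeakPartial (1, 0) g gx ∧ MemLp gx 2 (volume.restrict phase) ∧
      ∀ φ : ℝ × ℝ → ℝ, ContDiff ℝ ∞ φ → HasCompactSupport φ →
        ∫ p in phase, (g p * fderiv ℝ φ p (1, 0) + gx p * φ p) =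
          ∫ v, (γ₁ v * φ (1, v) - γ₀ v * φ (0, v))

/-- The linear feedback boundary condition with matrix `K = [[k₀₀, k₁₀], [k₀₁, k₁₁]]`:
`g(0,v) = k₀₀ g(0,-v) + k₁₀ g(1,v)` for `v > 0` and
`g(1,v) = k₀₁ g(0,v) + k₁₁ g(1,-v)` for `v < 0`. -/
def FeedbackBC (K : Matrix (Fin 2) (Fin 2) ℝ) (g : ℝ × ℝ → ℝ) : Prop :=
  ∃ γ₀ γ₁ : ℝ → ℝ, IsBoundaryTrace g γ₀ γ₁ ∧
    (∀ᵐ v : ℝ, 0 < v → γ₀ v = K 0 0 * γ₀ (-v) + K 0 1 * γ₁ v) ∧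
    (∀ᵐ v : ℝ, v < 0 → γ₁ v = K 1 0 * γ₀ v + K 1 1 * γ₁ (-v))

/-- The density `σ(t,x) = ∫ f(t,x,v) dv`. -/
def density (f : ℝ → ℝ × ℝ → ℝ) (t x : ℝ) : ℝ := ∫ v, f t (x, v)

/-- `s'` is the weak derivative of `s` on `(0,1)`. -/
def HasWeakDeriv (s s' : ℝ → ℝ) : Prop :=
  LocallyIntegrableOn s (Ioo 0 1) ∧ LocallyIntegrableOn s' (Ioo 0 1) ∧
    ∀ φ : ℝ → ℝ, ContDiff ℝ ∞ φ → HasCompactSupport φ → tsupport φ ⊆ Ioo 0 1 →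
      ∫ x in Ioo (0 : ℝ) 1, s x * deriv φ x = - ∫ x in Ioo (0 : ℝ) 1, s' x * φ x

/-- Test functions `φ(t,x)` for the limit equation: smooth, supported in a compact time interval
inside `(0,∞)`, and such that the boundary term `∂ₓσ(t,1) φ(t,1) - ∂ₓσ(t,0) φ(t,0)` vanishes
whenever `p = ∂ₓσ(t,0)` and `q = ∂ₓσ(t,1)` satisfy the limit boundary condition
`p = -k₀₀ p + k₁₀ q`, `q = k₀₁ p - k₁₁ q`. For periodic feedback the last condition reads
`φ(t,0) = φ(t,1)`. -/
structure IsTestFunction (K : Matrix (Fin 2) (Fin 2) ℝ) (φ : ℝ × ℝ → ℝ) : Prop where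
  smooth : ContDiff ℝ ∞ φ
  support : ∃ t₁ t₂ : ℝ, 0 < t₁ ∧ ∀ t x, t ∉ Icc t₁ t₂ → φ (t, x) = 0
  boundary : ∀ p q : ℝ, p = -K 0 0 * p + K 0 1 * q → q = K 1 0 * p - K 1 1 * q →
    ∀ t, q * φ (t, 1) = p * φ (t, 0)

/-- `s(t,x)` is a weak solution of `∂ₜ s - ∂ₓ (∂ₓ s + E s) = 0` on `(0,∞) × (0,1)`, the boundary
condition on `∂ₓ s` (see `IsTestFunction`) being included in the weak form. -/
def IsWeakDriftDiffusion (K : Matrix (Fin 2) (Fin 2) ℝ) (E s : ℝ → ℝ → ℝ) : Prop :=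
  ∃ sx : ℝ → ℝ → ℝ, (∀ t, 0 ≤ t → HasWeakDeriv (s t) (sx t)) ∧
    ∀ φ : ℝ × ℝ → ℝ, IsTestFunction K φ →
      ∫ t in Ioi (0 : ℝ), ∫ x in Ioo (0 : ℝ) 1,
        (s t x * fderiv ℝ φ (t, x) (1, 0)
          - (sx t x + E t x * s t x) * fderiv ℝ φ (t, x) (0, 1)) = 0

/-- Weak solutions `f ∈ C⁰([0,∞); H¹_{x,v})` of the Vlasov-Fokker-Planck equation
`ε ∂ₜ f + v ∂ₓ f - E ∂ᵥ f = ε⁻¹ ∂ᵥ(M ∂ᵥ(f / M))` with feedback matrix `K` in the (formal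
hydrodynamic) limit `ε = 0`: `f` is a local equilibrium `σ(t,x) M(v)` and its density solves
the limit drift-diffusion equation. -/
structure IsLimitSolution (K : Matrix (Fin 2) (Fin 2) ℝ) (E : ℝ → ℝ → ℝ)
    (f : ℝ → ℝ × ℝ → ℝ) : Prop where
  continuous : ContinuousInH1 f
  equilibrium : ∀ t, 0 ≤ t →
    ∀ᵐ p ∂(volume.restrict phase), f t p = density f t p.1 * maxwellian p.2
  feedback : ∀ t, 0 ≤ t → FeedbackBC K (f t)
  macroscopic : IsWeakDriftDiffusion K E (density f)

/-- The constant `C_s` of the Poincaré inequality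
`‖∂ₓ s‖² ≥ (C_s / 2) ‖s - ∫ s‖_V²` for all `s ∈ H¹(0,1)`, with `0 < C_s ≤ 1`. -/
def IsPoincareConstant (Cs : ℝ) : Prop :=
  0 < Cs ∧ Cs ≤ 1 ∧
    ∀ s s' : ℝ → ℝ, HasWeakDeriv s s' →
      MemLp s 2 (volume.restrict (Ioo 0 1)) → MemLp s' 2 (volume.restrict (Ioo 0 1)) →
        Cs / 2 * ((∫ x in Ioo (0 : ℝ) 1, (s x - ∫ y in Ioo (0 : ℝ) 1, s y) ^ 2)
          + ∫ x in Ioo (0 : ℝ) 1, s' x ^ 2) ≤ ∫ x in Ioo (0 : ℝ) 1, s' x ^ 2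

/-- The coercivity constant `λ = 1/4`. -/
def lam : ℝ := 1 / 4

/-- The assumptions on the electric field `E(t,x)`, `t ≥ 0`, `x ∈ [0,1]`. -/
structure FieldAssumption (Cs CE : ℝ) (E : ℝ → ℝ → ℝ) : Prop where
  continuous : ContinuousOn (fun p : ℝ × ℝ => E p.1 p.2) (Ici 0 ×ˢ Icc 0 1)
  smooth : ∀ t, 0 ≤ t → ContDiffOn ℝ 3 (E t) (Icc 0 1)
  bound : ∀ t, 0 ≤ t → ∀ x ∈ Icc (0 : ℝ) 1, |E t x| ≤ CE / 2
  bound_deriv : ∀ t, 0 ≤ t → ∀ x ∈ Icc (0 : ℝ) 1,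
    |iteratedDerivWithin 1 (E t) (Icc 0 1) x| ≤ CE / 2
  bound_deriv3 : ∀ t, 0 ≤ t → ∀ x ∈ Icc (0 : ℝ) 1,
    |iteratedDerivWithin 3 (E t) (Icc 0 1) x| ≤ CE / 2
  small : CE / 2 ≤ lam * Cs / 16
  left : ∀ t, 0 ≤ t → E t 0 = 0
  right : ∀ t, 0 ≤ t → E t 1 = 0
  periodic_deriv2 : ∀ t, 0 ≤ t →
    iteratedDerivWithin 2 (E t) (Icc 0 1) 0 = iteratedDerivWithin 2 (E t) (Icc 0 1) 1

end

end VFP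

/-! A local equilibrium `σ(t,x) M(v)` has all its information in `σ`. Since `∫ M = 1`, the squared
`V`-norm of `f / √M` is exactly the squared `H¹(0,1)` norm `N(t)` of `σ(t)`. The claim is thus
exponential decay in `H¹` for the periodic equation `∂ₜσ = ∂ₓ²σ + ∂ₓ(Eσ)` with zero mass.

Formally, diffusion damps `N` through the spectral gap `(2π)² ≥ 36`, while the forcing satisfies
`‖∂ₓ(Eσ)‖² ≤ (CE²/2) N` with `CE` small. As `σ` is only in `H¹`, differentiating `N` is not
justified. Real Fourier coefficients are used instead: each solves a classical ODE
(`hasDerivAt_cosCoeff`, `hasDerivAt_sinCoeff`), and a finite sum `P` of their squares with weights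
`1 + freq k ^ 2` satisfies `P' ≤ -36 P + CE² N` (`weighted_damping_le`,
`exists_hasDerivAt_partialNormSq`). Parseval recovers `N` as the supremum of the `P`.

Integrating this inequality turns a bound `N ≤ m e^{-νt}` into `N ≤ (CE² m / (36 - ν) + N(0))
e^{-νt}` (`normSq_le_of_bound`). Taking the best `m` on `[0,t]` closes the estimate
(`normSq_decay`). Every `ν ≤ 1` is allowed, and `2ξ` is well below `1`. -/

namespace VFP

/-! ### Distributional derivatives in time -/

theorem exists_antideriv_test {κ : ℝ → ℝ} (hκ : ContDiff ℝ ∞ κ) (hc : HasCompactSupport κ)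
    (hs : tsupport κ ⊆ Ioi 0) (h0 : ∫ t, κ t = 0) :
    ∃ θ : ℝ → ℝ, ContDiff ℝ ∞ θ ∧ HasCompactSupport θ ∧ tsupport θ ⊆ Ioi 0 ∧ deriv θ = κ := by
  have hi : Integrable κ := hκ.continuous.integrable_of_hasCompactSupport hc
  obtain ⟨a, b, ha, hab⟩ : ∃ a b : ℝ, 0 < a ∧ tsupport κ ⊆ Icc a b := by
    rcases (tsupport κ).eq_empty_or_nonempty with he | hne
    · exact ⟨1, 1, one_pos, by simp [he]⟩
    · obtain ⟨x, hx, hxm⟩ := hc.isCompact.exists_isMinOn hne continuousOn_id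
      obtain ⟨y, hy, hym⟩ := hc.isCompact.exists_isMaxOn hne continuousOn_id
      exact ⟨x, y, hs hx, fun z hz => ⟨hxm hz, hym hz⟩⟩
  have hz : ∀ t, t ∉ Icc a b → κ t = 0 := fun t ht => by
    by_contra h
    exact ht (hab (subset_tsupport κ h))
  have hd : ∀ t, HasDerivAt (fun t => ∫ s in (0 : ℝ)..t, κ s) (κ t) t := fun t =>
    intervalIntegral.integral_hasDerivAt_right hi.intervalIntegrable
      hκ.continuous.stronglyMeasurable.stronglyMeasurableAtFilter hκ.continuous.continuousAt
  have hder : deriv (fun t => ∫ s in (0 : ℝ)..t, κ s) = κ := funext fun t => (hd t).deriv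
  have hzero : ∀ t, t ∉ Icc a b → ∫ s in (0 : ℝ)..t, κ s = 0 := by
    intro t ht
    rcases lt_or_ge t a with h | h
    · have : ∀ s ∈ uIcc 0 t, κ s = 0 := by
        intro s hs'
        apply hz
        intro hs2
        have : s ≤ max 0 t := (mem_uIcc.1 hs').elim (fun h => h.2.trans (le_max_right _ _))
          (fun h => h.2.trans (le_max_left _ _))
        have := hs2.1
        rcases max_lt_iff.2 ⟨ha, h⟩ |>.trans_le this |>.not_ge ‹_›
      rw [intervalIntegral.integral_congr (g := fun _ => (0 : ℝ)) this]
      simp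
    · have hb : b < t := by
        by_contra hb
        exact ht ⟨h, not_lt.1 hb⟩
      rw [intervalIntegral.integral_of_le (ha.le.trans h),
        setIntegral_eq_integral_of_forall_compl_eq_zero, h0]
      intro s hs'
      apply hz
      intro hs2
      exact hs' ⟨ha.trans_le hs2.1, hs2.2.trans hb.le⟩
  have hsub : tsupport (fun t => ∫ s in (0 : ℝ)..t, κ s) ⊆ Icc a b := by
    apply closure_minimal _ isClosed_Icc
    intro t ht
    by_contra h
    exact ht (hzero t h)
  refine ⟨fun t => ∫ s in (0 : ℝ)..t, κ s, ?_, ?_, ?_, hder⟩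
  · rw [contDiff_infty_iff_deriv, hder]
    exact ⟨fun t => (hd t).differentiableAt, hκ⟩
  · exact HasCompactSupport.of_support_subset_isCompact isCompact_Icc
      ((subset_tsupport _).trans hsub)
  · exact hsub.trans fun x hx => ha.trans_le hx.1

/-- The lemma of du Bois-Reymond on the half line. -/
theorem eqOn_const_of_integral_deriv_mul_eq_zero {C : ℝ → ℝ} (hC : Continuous C)
    (h : ∀ θ : ℝ → ℝ, ContDiff ℝ ∞ θ → HasCompactSupport θ → tsupport θ ⊆ Ioi 0 →
      ∫ t, deriv θ t * C t = 0) : ∃ A : ℝ, ∀ t, 0 < t → C t = A := by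
  let ρ₀ : ContDiffBump (1 : ℝ) := ⟨1 / 4, 1 / 2, by norm_num, by norm_num⟩
  let ρ : ℝ → ℝ := ρ₀.normed volume
  have hρ : ContDiff ℝ ∞ ρ := ρ₀.contDiff_normed
  have hρc : HasCompactSupport ρ := ρ₀.hasCompactSupport_normed
  have hρi : ∫ t, ρ t = 1 := ρ₀.integral_normed
  have hρs : tsupport ρ ⊆ Ioi 0 := by
    have : tsupport ρ = Metric.closedBall 1 (1 / 2) := ρ₀.tsupport_normed_eq
    rw [this, Real.closedBall_eq_Icc]
    intro x hx
    have := hx.1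
    simp only [mem_Ioi]
    linarith
  refine ⟨∫ t, ρ t * C t, ?_⟩
  have key : ∀ η : ℝ → ℝ, ContDiff ℝ ∞ η → HasCompactSupport η → tsupport η ⊆ Ioi 0 →
      ∫ t, η t • (C t - ∫ t, ρ t * C t) = 0 := by
    intro η h1 h2 h3
    have hηi : Integrable η := h1.continuous.integrable_of_hasCompactSupport h2
    have hρI : Integrable ρ := hρ.continuous.integrable_of_hasCompactSupport hρc
    have hcs : HasCompactSupport (fun t => (∫ s, η s) * ρ t) := hρc.mul_left
    -- Subtracting the multiple of `ρ` with the same integral leaves a function of zero mean, hence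
    -- the derivative of a test function.
    obtain ⟨θ, t1, t2, t3, t4⟩ := exists_antideriv_test (κ := fun t => η t - (∫ s, η s) * ρ t)
      (h1.sub (contDiff_const.mul hρ)) (h2.sub hcs)
      ((tsupport_sub _ _).trans (union_subset h3
        ((tsupport_mul_subset_right).trans hρs)))
      (by rw [integral_sub hηi (hρI.const_mul _), integral_const_mul, hρi]; ring)
    have := h θ t1 t2 t3
    rw [t4] at this
    have i1 : Integrable (fun t => η t * C t) :=
      (h1.continuous.mul hC).integrable_of_hasCompactSupport h2.mul_right
    have i2 : Integrable (fun t => ρ t * C t) :=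
      (hρ.continuous.mul hC).integrable_of_hasCompactSupport hρc.mul_right
    have e1 : ∫ t, (η t - (∫ s, η s) * ρ t) * C t
        = (∫ t, η t * C t) - (∫ s, η s) * ∫ t, ρ t * C t := by
      rw [← integral_const_mul, ← integral_sub i1 (i2.const_mul _)]
      congr 1; ext t; ring
    simp only [smul_eq_mul, mul_sub]
    rw [integral_sub i1 (hηi.mul_const _), integral_mul_const]
    linarith
  have hae := isOpen_Ioi.ae_eq_zero_of_integral_contDiff_smul_eq_zero (μ := volume)
    (f := fun t => C t - ∫ t, ρ t * C t)
    (Continuous.locallyIntegrable (by fun_prop) |>.locallyIntegrableOn _) key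
  have hae' : C =ᵐ[volume.restrict (Ioi 0)] fun _ => ∫ t, ρ t * C t := by
    rw [Filter.EventuallyEq, ae_restrict_iff' measurableSet_Ioi]
    filter_upwards [hae] with t ht hh
    linarith [ht hh]
  exact fun t ht => Measure.eqOn_open_of_ae_eq hae' isOpen_Ioi hC.continuousOn
    continuousOn_const ht

/-- Adding to `c` a primitive of `d` gives a continuous function with zero distributional
derivative, so a constant. A weak ODE with continuous data therefore holds classically. -/
theorem hasDerivAt_of_integral_test {c d : ℝ → ℝ} (hc : Continuous c) (hd : Continuous d)
    (h : ∀ θ : ℝ → ℝ, ContDiff ℝ ∞ θ → HasCompactSupport θ → tsupport θ ⊆ Ioi 0 →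
      ∫ t in Ioi (0 : ℝ), (deriv θ t * c t - θ t * d t) = 0) :
    ∀ t, 0 < t → HasDerivAt c (-d t) t := by
  set D : ℝ → ℝ := fun t => ∫ s in (0 : ℝ)..t, d s with hD
  have hDd : ∀ t, HasDerivAt D (d t) t := fun t =>
    intervalIntegral.integral_hasDerivAt_right (hd.intervalIntegrable _ _)
      hd.stronglyMeasurable.stronglyMeasurableAtFilter hd.continuousAt
  have hDc : Continuous D := continuous_iff_continuousAt.2 fun t => (hDd t).continuousAt
  obtain ⟨A, hA⟩ := eqOn_const_of_integral_deriv_mul_eq_zero (C := fun t => c t + D t)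
    (hc.add hDc) (by
      intro θ h1 h2 h3
      have h4 := h θ h1 h2 h3
      have hθ' : Continuous (deriv θ) := h1.continuous_deriv (by simp)
      have hz : ∀ t, t ∉ Ioi (0 : ℝ) → θ t = 0 ∧ deriv θ t = 0 := by
        intro t ht
        have h5 : t ∉ tsupport θ := fun hh => ht (h3 hh)
        exact ⟨image_eq_zero_of_notMem_tsupport h5, by
          by_contra h6
          exact h5 (support_deriv_subset h6)⟩
      rw [setIntegral_eq_integral_of_forall_compl_eq_zero (by
        intro t ht; rw [(hz t ht).1, (hz t ht).2]; ring)] at h4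
      have i1 : Integrable (fun t => deriv θ t * c t) :=
        (hθ'.mul hc).integrable_of_hasCompactSupport h2.deriv.mul_right
      have i2 : Integrable (fun t => θ t * d t) :=
        (h1.continuous.mul hd).integrable_of_hasCompactSupport h2.mul_right
      have i3 : Integrable (fun t => deriv θ t * D t) :=
        (hθ'.mul hDc).integrable_of_hasCompactSupport h2.deriv.mul_right
      have i4 : Integrable (fun t => θ t * D t) :=
        (h1.continuous.mul hDc).integrable_of_hasCompactSupport h2.mul_right
      have e := integral_mul_deriv_eq_deriv_mul_of_integrable (u := θ) (v := D)
        (u' := deriv θ) (v' := d)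
        (fun t _ => (h1.differentiable (by simp) t).hasDerivAt) (fun t _ => hDd t) i2 i3 i4
      rw [integral_sub i1 i2, e] at h4
      simp only [mul_add]
      rw [integral_add i1 i3]
      linarith)
  intro t ht
  have : (fun s => A - D s) =ᶠ[𝓝 t] c := by
    filter_upwards [Ioi_mem_nhds ht] with s hs
    linarith [hA s hs]
  exact (((hDd t).const_sub A).congr_of_eventuallyEq this.symm)

/-! ### Weak derivatives on the phase space and tensor products -/

theorem isOpen_phase : IsOpen phase := isOpen_Ioo.prod isOpen_univ

theorem volume_restrict_phase :
    (volume : Measure (ℝ × ℝ)).restrict phase = (volume.restrict (Ioo (0 : ℝ) 1)).prod volume := by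
  rw [phase, Measure.volume_eq_prod, ← Measure.prod_restrict, Measure.restrict_univ]

theorem integrable_mul_of_locallyIntegrableOn {X : Type*} [TopologicalSpace X] [T2Space X]
    [MeasurableSpace X] [OpensMeasurableSpace X] {μ : Measure X} {U : Set X} {g ψ : X → ℝ}
    (hg : LocallyIntegrableOn g U μ)
    (hψ : Continuous ψ) (hc : HasCompactSupport ψ) (hs : tsupport ψ ⊆ U) :
    Integrable (fun x => g x * ψ x) (μ.restrict U) := by
  have h1 : IntegrableOn (fun x => g x * ψ x) (tsupport ψ) μ :=
    (hg.integrableOn_compact_subset hs hc.isCompact).mul_continuousOn hψ.continuousOn hc.isCompact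
  refine (integrableOn_iff_integrable_of_support_subset ?_).1 h1 |>.integrableOn
  intro x hx
  exact subset_tsupport ψ (fun h => hx (by simp [h]))

theorem locallyIntegrableOn_tensor {s w : ℝ → ℝ} (hs : LocallyIntegrableOn s (Ioo 0 1))
    (hw : Continuous w) : LocallyIntegrableOn (fun p : ℝ × ℝ => s p.1 * w p.2) phase := by
  rw [locallyIntegrableOn_iff isOpen_phase.isLocallyClosed]
  intro K hK hKc
  have h1 : IntegrableOn s (Prod.fst '' K) :=
    hs.integrableOn_compact_subset (by rintro _ ⟨p, hp, rfl⟩; exact (hK hp).1)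
      (hKc.image continuous_fst)
  have h2 : IntegrableOn w (Prod.snd '' K) :=
    hw.continuousOn.integrableOn_compact (hKc.image continuous_snd)
  have h3 : IntegrableOn (fun p : ℝ × ℝ => s p.1 * w p.2) ((Prod.fst '' K) ×ˢ (Prod.snd '' K)) := by
    rw [IntegrableOn, Measure.volume_eq_prod, ← Measure.prod_restrict]
    exact Integrable.mul_prod h1 h2
  exact h3.mono_set fun p hp => ⟨⟨p, hp, rfl⟩, ⟨p, hp, rfl⟩⟩

theorem fderiv_one_zero_eq_deriv {φ : ℝ × ℝ → ℝ} (hφ : Differentiable ℝ φ) (x v : ℝ) :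
    fderiv ℝ φ (x, v) (1, 0) = deriv (fun y => φ (y, v)) x := by
  have h1 : HasDerivAt (fun y : ℝ => (y, v)) (1, 0) x :=
    (hasDerivAt_id x).prodMk (hasDerivAt_const x v)
  exact (((hφ (x, v)).hasFDerivAt.comp_hasDerivAt x h1).deriv).symm

theorem fderiv_zero_one_eq_deriv {φ : ℝ × ℝ → ℝ} (hφ : Differentiable ℝ φ) (t x : ℝ) :
    fderiv ℝ φ (t, x) (0, 1) = deriv (fun y => φ (t, y)) x := by
  have h1 : HasDerivAt (fun y : ℝ => (t, y)) (0, 1) x :=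
    (hasDerivAt_const x t).prodMk (hasDerivAt_id x)
  exact (((hφ (t, x)).hasFDerivAt.comp_hasDerivAt x h1).deriv).symm

/-- By Fubini, with `v` integrated last: for fixed `v` the slice of a phase-space test function is a
test function on `(0,1)`, and `w v` is a constant factor. -/
theorem HasWeakDeriv.tensor {s s' w : ℝ → ℝ} (h : HasWeakDeriv s s') (hw : Continuous w) :
    HasWeakPartial (1, 0) (fun p => s p.1 * w p.2) (fun p => s' p.1 * w p.2) := by
  obtain ⟨h1, h2, h3⟩ := h
  refine ⟨locallyIntegrableOn_tensor h1 hw, locallyIntegrableOn_tensor h2 hw, ?_⟩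
  intro φ hφ hc hsupp
  have hd : Differentiable ℝ φ := hφ.differentiable (by simp)
  have hfd : Continuous fun p => fderiv ℝ φ p (1, 0) :=
    (hφ.continuous_fderiv (by simp)).clm_apply continuous_const
  have hcd : HasCompactSupport fun p => fderiv ℝ φ p (1, 0) := hc.fderiv_apply ℝ (1, 0)
  have hsd : tsupport (fun p => fderiv ℝ φ p (1, 0)) ⊆ tsupport φ := tsupport_fderiv_apply_subset ℝ _
  have i1 := integrable_mul_of_locallyIntegrableOn
    (locallyIntegrableOn_tensor h1 hw) hfd hcd (hsd.trans hsupp)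
  have i2 := integrable_mul_of_locallyIntegrableOn
    (locallyIntegrableOn_tensor h2 hw) hφ.continuous hc hsupp
  rw [volume_restrict_phase] at i1 i2 ⊢
  rw [integral_prod_symm _ i1, integral_prod_symm _ i2, ← integral_neg]
  congr 1
  ext v
  have key := h3 (fun x => φ (x, v)) (hφ.comp (contDiff_id.prodMk contDiff_const)) ?_ ?_
  · have e1 : ∀ x, s x * w v * fderiv ℝ φ (x, v) (1, 0)
        = w v * (s x * deriv (fun x => φ (x, v)) x) := fun x => by
      rw [fderiv_one_zero_eq_deriv hd]; ring
    have e2 : ∀ x, s' x * w v * φ (x, v) = w v * (s' x * φ (x, v)) := fun x => by ring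
    simp only [e1, e2, integral_const_mul, key]
    ring
  · exact HasCompactSupport.of_support_subset_isCompact (hc.isCompact.image continuous_fst)
      fun x hx => ⟨(x, v), subset_tsupport _ hx, rfl⟩
  · have : tsupport (fun x => φ (x, v)) ⊆ (fun x => (x, v)) ⁻¹' tsupport φ :=
      closure_minimal (fun x hx => subset_tsupport φ hx)
        ((isClosed_tsupport φ).preimage (by fun_prop))
    exact fun x hx => (hsupp (this hx)).1

theorem HasWeakPartial.ae_eq {e : ℝ × ℝ} {g g₁ g₂ : ℝ × ℝ → ℝ} (h₁ : HasWeakPartial e g g₁)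
    (h₂ : HasWeakPartial e g g₂) : g₁ =ᵐ[volume.restrict phase] g₂ := by
  have key := isOpen_phase.ae_eq_zero_of_integral_contDiff_smul_eq_zero (μ := volume)
    (f := fun p => g₁ p - g₂ p) (h₁.2.1.sub h₂.2.1) (by
      intro φ h1 h2 h3
      have i1 := integrable_mul_of_locallyIntegrableOn h₁.2.1
        h1.continuous h2 h3
      have i2 := integrable_mul_of_locallyIntegrableOn h₂.2.1
        h1.continuous h2 h3
      rw [← setIntegral_eq_integral_of_forall_compl_eq_zero (s := phase)]
      · have e : ∀ p, φ p • (g₁ p - g₂ p) = g₁ p * φ p - g₂ p * φ p := fun p => by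
          rw [smul_eq_mul]; ring
        simp only [e]
        rw [integral_sub i1 i2]
        linarith [h₁.2.2 φ h1 h2 h3, h₂.2.2 φ h1 h2 h3]
      · intro p hp
        rw [image_eq_zero_of_notMem_tsupport fun hh => hp (h3 hh), zero_smul])
  rw [Filter.EventuallyEq, ae_restrict_iff' isOpen_phase.measurableSet]
  filter_upwards [key] with p hp hh
  linarith [hp hh]

theorem HasWeakPartial.congr {e : ℝ × ℝ} {g g₁ g₂ : ℝ × ℝ → ℝ} (h : HasWeakPartial e g g₁)
    (hg : g =ᵐ[volume.restrict phase] g₂) : HasWeakPartial e g₂ g₁ := by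
  refine ⟨?_, h.2.1, fun φ h1 h2 h3 => ?_⟩
  · rw [locallyIntegrableOn_iff isOpen_phase.isLocallyClosed]
    intro K hK hKc
    exact (h.1.integrableOn_compact_subset hK hKc).congr (ae_restrict_of_ae_restrict_of_subset hK hg)
  · rw [← h.2.2 φ h1 h2 h3]
    apply integral_congr_ae
    filter_upwards [hg] with p hp
    rw [hp]

theorem vNormSq_eq {g gx : ℝ × ℝ → ℝ} (h : HasWeakPartial (1, 0) g gx) :
    vNormSq g = (∫⁻ p in phase, ‖g p‖ₑ ^ 2) + ∫⁻ p in phase, ‖gx p‖ₑ ^ 2 := by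
  refine le_antisymm (iInf₂_le gx h) (le_iInf₂ fun g' h' => ?_)
  gcongr 1
  apply le_of_eq
  apply lintegral_congr_ae
  filter_upwards [h.ae_eq h'] with p hp
  rw [hp]

theorem le_h1NormSq {g gx : ℝ × ℝ → ℝ} (h : HasWeakPartial (1, 0) g gx) :
    (∫⁻ p in phase, ‖g p‖ₑ ^ 2) + ∫⁻ p in phase, ‖gx p‖ₑ ^ 2 ≤ h1NormSq g := by
  refine le_iInf fun g' => le_iInf fun gv => le_iInf fun h' => le_iInf fun _ => ?_
  refine le_trans ?_ le_self_add
  gcongr 1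
  apply le_of_eq
  apply lintegral_congr_ae
  filter_upwards [h.ae_eq h'] with p hp
  rw [hp]

theorem HasWeakDeriv.aestronglyMeasurable {s s' : ℝ → ℝ} (h : HasWeakDeriv s s') :
    AEStronglyMeasurable s (volume.restrict (Ioo 0 1)) :=
  h.1.aestronglyMeasurable

theorem HasWeakDeriv.aestronglyMeasurable_deriv {s s' : ℝ → ℝ} (h : HasWeakDeriv s s') :
    AEStronglyMeasurable s' (volume.restrict (Ioo 0 1)) :=
  h.2.1.aestronglyMeasurable

/-! ### Reduction of the phase-space norms to `H¹(0,1)` -/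

theorem lintegral_tensor {s w : ℝ → ℝ} (hs : AEStronglyMeasurable s (volume.restrict (Ioo 0 1)))
    (hw : Continuous w) :
    ∫⁻ p in phase, ‖s p.1 * w p.2‖ₑ ^ 2 = (∫⁻ x in Ioo (0 : ℝ) 1, ‖s x‖ₑ ^ 2) * ∫⁻ v, ‖w v‖ₑ ^ 2 := by
  rw [volume_restrict_phase, ← lintegral_prod_mul (hs.enorm.pow_const 2)
    (hw.aestronglyMeasurable.enorm.pow_const 2)]
  simp only [enorm_mul, mul_pow]

theorem maxwellian_pos (v : ℝ) : 0 < maxwellian v := by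
  unfold maxwellian; positivity

theorem continuous_maxwellian : Continuous maxwellian := by
  unfold maxwellian; fun_prop

theorem maxwellian_eq_gaussianPDFReal : maxwellian = ProbabilityTheory.gaussianPDFReal 0 1 := by
  ext v; simp [maxwellian, ProbabilityTheory.gaussianPDFReal]

theorem maxwellian_le_one (v : ℝ) : maxwellian v ≤ 1 := by
  unfold maxwellian
  have h1 : (1 : ℝ) ≤ Real.sqrt (2 * Real.pi) := by
    rw [Real.one_le_sqrt]; linarith [Real.pi_gt_three]
  have h2 : Real.exp (-(v ^ 2) / 2) ≤ 1 := Real.exp_le_one_iff.2 (by nlinarith [sq_nonneg v])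
  exact mul_le_one₀ (inv_le_one_of_one_le₀ h1) (Real.exp_pos _).le h2

theorem lintegral_sqrt_maxwellian : ∫⁻ v, ‖Real.sqrt (maxwellian v)‖ₑ ^ 2 = 1 := by
  rw [← ProbabilityTheory.lintegral_gaussianPDFReal_eq_one 0 one_ne_zero]
  congr 1; ext v
  rw [← maxwellian_eq_gaussianPDFReal, Real.enorm_of_nonneg (Real.sqrt_nonneg _),
    ← ENNReal.ofReal_pow (Real.sqrt_nonneg _), Real.sq_sqrt (maxwellian_pos v).le]

theorem lintegral_maxwellian_sq_ne_zero : ∫⁻ v, ‖maxwellian v‖ₑ ^ 2 ≠ 0 := by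
  rw [Ne, lintegral_eq_zero_iff (continuous_maxwellian.measurable.enorm.pow_const 2)]
  intro h
  obtain ⟨v, hv⟩ := h.exists
  simp [(maxwellian_pos v).ne'] at hv

theorem lintegral_maxwellian_sq_ne_top : ∫⁻ v, ‖maxwellian v‖ₑ ^ 2 ≠ ⊤ := by
  refine ne_top_of_le_ne_top ENNReal.one_ne_top ?_
  rw [← ProbabilityTheory.lintegral_gaussianPDFReal_eq_one 0 one_ne_zero]
  gcongr with v
  rw [← maxwellian_eq_gaussianPDFReal, Real.enorm_of_nonneg (maxwellian_pos v).le,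
    ← ENNReal.ofReal_pow (maxwellian_pos v).le]
  exact ENNReal.ofReal_le_ofReal (by nlinarith [maxwellian_pos v, maxwellian_le_one v])

/-- The squared `H¹(0,1)` norm of a function with weak derivative `s'`. -/
noncomputable def energy (s s' : ℝ → ℝ) : ℝ≥0∞ :=
  (∫⁻ x in Ioo (0 : ℝ) 1, ‖s x‖ₑ ^ 2) + ∫⁻ x in Ioo (0 : ℝ) 1, ‖s' x‖ₑ ^ 2

/-- Dividing by `√M` leaves `s(x) √M(v)`, and `√M` has unit `L²` norm; hence an equality with no
constant. -/
theorem HasWeakDeriv.vNormSq_eq_energy {s s' : ℝ → ℝ} (h : HasWeakDeriv s s')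
    {g : ℝ × ℝ → ℝ} (hg : ∀ᵐ p ∂(volume.restrict phase), g p = s p.1 * maxwellian p.2) :
    vNormSq (fun p => g p / Real.sqrt (maxwellian p.2)) = energy s s' := by
  have hw : Continuous fun v => Real.sqrt (maxwellian v) := continuous_maxwellian.sqrt
  have hg' : (fun p : ℝ × ℝ => s p.1 * Real.sqrt (maxwellian p.2)) =ᵐ[volume.restrict phase]
      fun p => g p / Real.sqrt (maxwellian p.2) := by
    filter_upwards [hg] with p hp
    have := Real.sqrt_pos.2 (maxwellian_pos p.2)
    rw [hp, eq_div_iff this.ne', mul_assoc, Real.mul_self_sqrt (maxwellian_pos _).le]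
  rw [vNormSq_eq ((h.tensor hw).congr hg')]
  have e : ∫⁻ p in phase, ‖g p / Real.sqrt (maxwellian p.2)‖ₑ ^ 2
      = ∫⁻ p in phase, ‖s p.1 * Real.sqrt (maxwellian p.2)‖ₑ ^ 2 := by
    apply lintegral_congr_ae
    filter_upwards [hg'] with p hp
    rw [hp]
  rw [e, lintegral_tensor h.aestronglyMeasurable hw,
    lintegral_tensor h.aestronglyMeasurable_deriv hw, lintegral_sqrt_maxwellian, mul_one, mul_one,
    energy]

/-- The unweighted `H¹` norm sees `M` instead of `√M`, which costs the factor `∫ M²`. This factor is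
positive and finite, so finiteness and continuity in time pass from `f` to its density. -/
theorem HasWeakDeriv.energy_mul_le {s s' : ℝ → ℝ} (h : HasWeakDeriv s s')
    {g : ℝ × ℝ → ℝ} (hg : ∀ᵐ p ∂(volume.restrict phase), g p = s p.1 * maxwellian p.2) :
    energy s s' * (∫⁻ v, ‖maxwellian v‖ₑ ^ 2) ≤ h1NormSq g := by
  have hg' : (fun p : ℝ × ℝ => s p.1 * maxwellian p.2) =ᵐ[volume.restrict phase] g := by
    filter_upwards [hg] with p hp using hp.symm
  refine le_trans (le_of_eq ?_) (le_h1NormSq ((h.tensor continuous_maxwellian).congr hg'))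
  have e : ∫⁻ p in phase, ‖g p‖ₑ ^ 2 = ∫⁻ p in phase, ‖s p.1 * maxwellian p.2‖ₑ ^ 2 := by
    apply lintegral_congr_ae
    filter_upwards [hg] with p hp
    rw [hp]
  rw [e, lintegral_tensor h.aestronglyMeasurable continuous_maxwellian,
    lintegral_tensor h.aestronglyMeasurable_deriv continuous_maxwellian, energy, add_mul]

theorem memLp_two_of_lintegral_lt_top {X : Type*} [MeasurableSpace X] {μ : Measure X} {s : X → ℝ}
    (hs : AEStronglyMeasurable s μ) (h : ∫⁻ x, ‖s x‖ₑ ^ 2 ∂μ < ⊤) : MemLp s 2 μ := by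
  rw [memLp_two_iff_integrable_sq hs]
  refine ⟨hs.pow 2, ?_⟩
  simpa [HasFiniteIntegral, enorm_pow] using h

theorem HasWeakDeriv.memLp {s s' : ℝ → ℝ} (h : HasWeakDeriv s s') (he : energy s s' < ⊤) :
    MemLp s 2 (volume.restrict (Ioo 0 1)) ∧ MemLp s' 2 (volume.restrict (Ioo 0 1)) :=
  ⟨memLp_two_of_lintegral_lt_top h.aestronglyMeasurable (le_self_add.trans_lt he),
    memLp_two_of_lintegral_lt_top h.aestronglyMeasurable_deriv (le_add_self.trans_lt he)⟩

theorem HasWeakDeriv.sub {s s' r r' : ℝ → ℝ} (h : HasWeakDeriv s s') (k : HasWeakDeriv r r') :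
    HasWeakDeriv (fun x => s x - r x) (fun x => s' x - r' x) := by
  refine ⟨h.1.sub k.1, h.2.1.sub k.2.1, fun φ h1 h2 h3 => ?_⟩
  have hd : Continuous (deriv φ) := h1.continuous_deriv (by simp)
  have hds : tsupport (deriv φ) ⊆ Ioo 0 1 := (tsupport_deriv_subset).trans h3
  simp only [sub_mul]
  rw [integral_sub (integrable_mul_of_locallyIntegrableOn h.1 hd h2.deriv hds)
    (integrable_mul_of_locallyIntegrableOn k.1 hd h2.deriv hds),
    integral_sub (integrable_mul_of_locallyIntegrableOn h.2.1 h1.continuous h2 h3)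
    (integrable_mul_of_locallyIntegrableOn k.2.1 h1.continuous h2 h3), h.2.2 φ h1 h2 h3,
    k.2.2 φ h1 h2 h3]
  ring

theorem HasWeakDeriv.energy_lt_top {s s' : ℝ → ℝ} (h : HasWeakDeriv s s')
    {g : ℝ × ℝ → ℝ} (hg : ∀ᵐ p ∂(volume.restrict phase), g p = s p.1 * maxwellian p.2)
    (hfin : h1NormSq g < ⊤) : energy s s' < ⊤ := by
  by_contra hh
  rw [not_lt_top_iff] at hh
  have := (h.energy_mul_le hg).trans_lt hfin
  rw [hh, ENNReal.top_mul lintegral_maxwellian_sq_ne_zero] at this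
  exact lt_irrefl _ this

theorem tendsto_energy_sub {f : ℝ → ℝ × ℝ → ℝ} {s sx : ℝ → ℝ → ℝ} (hf : ContinuousInH1 f)
    (hs : ∀ t, 0 ≤ t → HasWeakDeriv (s t) (sx t))
    (he : ∀ t, 0 ≤ t → ∀ᵐ p ∂(volume.restrict phase), f t p = s t p.1 * maxwellian p.2)
    {t₀ : ℝ} (ht₀ : 0 ≤ t₀) :
    Tendsto (fun t => energy (fun x => s t x - s t₀ x) (fun x => sx t x - sx t₀ x))
      (𝓝[Ici 0] t₀) (𝓝 0) := by
  set c := ∫⁻ v, ‖maxwellian v‖ₑ ^ 2 with hc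
  have h1 : Tendsto (fun t => h1NormSq (fun p => f t p - f t₀ p) / c) (𝓝[Ici 0] t₀) (𝓝 0) := by
    have := ENNReal.Tendsto.div_const (hf.2 t₀ ht₀) (b := c)
      (Or.inr lintegral_maxwellian_sq_ne_zero)
    simpa using this
  refine tendsto_of_tendsto_of_tendsto_of_le_of_le' tendsto_const_nhds h1
    (Eventually.of_forall fun _ => zero_le) ?_
  filter_upwards [self_mem_nhdsWithin] with t ht
  rw [ENNReal.le_div_iff_mul_le (Or.inl lintegral_maxwellian_sq_ne_zero)
    (Or.inl lintegral_maxwellian_sq_ne_top)]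
  apply ((hs t ht).sub (hs t₀ ht₀)).energy_mul_le
  filter_upwards [he t ht, he t₀ ht₀] with p h1 h2
  rw [h1, h2, sub_mul]

/-! ### Periodicity of the density and integration by parts -/

theorem ae_eq_of_feedbackBC {γ₀ γ₁ : ℝ → ℝ}
    (h₀ : ∀ᵐ v : ℝ, 0 < v → γ₀ v = (!![0, 1; 1, 0] : Matrix (Fin 2) (Fin 2) ℝ) 0 0 * γ₀ (-v)
      + (!![0, 1; 1, 0] : Matrix (Fin 2) (Fin 2) ℝ) 0 1 * γ₁ v)
    (h₁ : ∀ᵐ v : ℝ, v < 0 → γ₁ v = (!![0, 1; 1, 0] : Matrix (Fin 2) (Fin 2) ℝ) 1 0 * γ₀ v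
      + (!![0, 1; 1, 0] : Matrix (Fin 2) (Fin 2) ℝ) 1 1 * γ₁ (-v)) : γ₀ =ᵐ[volume] γ₁ := by
  have h0 : ∀ᵐ v : ℝ, v ≠ 0 := by simp [ae_iff]
  filter_upwards [h₀, h₁, h0] with v a b c
  rcases lt_or_gt_of_ne c with h | h
  · simpa using (b h).symm
  · simpa using a h

theorem memLp_mul_continuousOn {f u : ℝ → ℝ} (hf : MemLp f 2 (volume.restrict (Ioo 0 1)))
    (hu : ContinuousOn u (Icc 0 1)) :
    MemLp (fun x => f x * u x) 2 (volume.restrict (Ioo 0 1)) := by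
  obtain ⟨C, hC⟩ := isCompact_Icc.exists_bound_of_continuousOn hu
  have hum : AEStronglyMeasurable u (volume.restrict (Ioo 0 1)) :=
    (hu.mono Ioo_subset_Icc_self).aestronglyMeasurable measurableSet_Ioo
  refine hf.of_le_mul (c := C) (hf.1.mul hum) ?_
  filter_upwards [ae_restrict_mem measurableSet_Ioo] with x hx
  rw [norm_mul, mul_comm]
  exact mul_le_mul_of_nonneg_right (hC x (Ioo_subset_Icc_self hx)) (norm_nonneg _)

/-- Green's formula is tested with `e(x) ψ(v)`. The two boundary terms cancel, because the traces
agree and `e 0 = e 1`; the `v`-integral factors out as the positive number `∫ M ψ`. -/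
theorem integral_periodic_test {s s' : ℝ → ℝ} {g : ℝ × ℝ → ℝ} (h : HasWeakDeriv s s')
    (hg : ∀ᵐ p ∂(volume.restrict phase), g p = s p.1 * maxwellian p.2)
    (hbc : FeedbackBC !![0, 1; 1, 0] g) (hfin : energy s s' < ⊤)
    {e : ℝ → ℝ} (he : ContDiff ℝ ∞ e) (hper : e 0 = e 1) :
    ∫ x in Ioo (0 : ℝ) 1, s' x * e x = - ∫ x in Ioo (0 : ℝ) 1, s x * deriv e x := by
  obtain ⟨γ₀, γ₁, ⟨-, -, -, gx, hgx, -, hgreen⟩, b₀, b₁⟩ := hbc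
  have hγ := ae_eq_of_feedbackBC b₀ b₁
  obtain ⟨m1, m2⟩ := h.memLp hfin
  have hgx' : (fun p : ℝ × ℝ => s' p.1 * maxwellian p.2) =ᵐ[volume.restrict phase] gx :=
    ((h.tensor continuous_maxwellian).congr (by
      filter_upwards [hg] with p hp using hp.symm)).ae_eq hgx
  -- The cutoff `χ` equals `1` near `[0,1]`: it makes the test function compactly supported without
  -- affecting it or its derivative there.
  let χ : ContDiffBump (1 / 2 : ℝ) := ⟨1, 2, one_pos, one_lt_two⟩
  let ψ : ContDiffBump (0 : ℝ) := ⟨1, 2, one_pos, one_lt_two⟩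
  have hχ1 : ∀ x ∈ Icc (0 : ℝ) 1, (χ : ℝ → ℝ) =ᶠ[𝓝 x] 1 := fun x hx =>
    χ.eventuallyEq_one_of_mem_ball (by
      rw [Metric.mem_ball, Real.dist_eq, abs_lt]
      constructor <;> linarith [hx.1, hx.2])
  have hχ : ∀ x ∈ Icc (0 : ℝ) 1, χ x = 1 := fun x hx => (hχ1 x hx).eq_of_nhds
  set φ : ℝ × ℝ → ℝ := fun p => (e p.1 * χ p.1) * ψ p.2 with hφ
  have hφs : ContDiff ℝ ∞ φ :=
    ((he.comp contDiff_fst).mul (χ.contDiff.comp contDiff_fst)).mul (ψ.contDiff.comp contDiff_snd)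
  have hφc : HasCompactSupport φ := by
    apply HasCompactSupport.of_support_subset_isCompact
      (χ.hasCompactSupport.isCompact.prod ψ.hasCompactSupport.isCompact)
    intro p hp
    simp only [hφ, Function.mem_support, ne_eq, mul_eq_zero, not_or] at hp
    exact ⟨subset_tsupport _ hp.1.2, subset_tsupport _ hp.2⟩
  have hG := hgreen φ hφs hφc
  have hR : ∫ v, (γ₁ v * φ (1, v) - γ₀ v * φ (0, v)) = 0 := by
    apply integral_eq_zero_of_ae
    filter_upwards [hγ] with v hv
    have c0 : χ (0 : ℝ) = 1 := hχ 0 (by simp)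
    have c1 : χ (1 : ℝ) = 1 := hχ 1 (by simp)
    simp only [hφ, c0, c1, hper, hv, sub_self, Pi.zero_apply]
  rw [hR] at hG
  have hL : ∫ p in phase, (g p * fderiv ℝ φ p (1, 0) + gx p * φ p)
      = ∫ p in phase, (s p.1 * deriv e p.1 + s' p.1 * e p.1) * (maxwellian p.2 * ψ p.2) := by
    apply integral_congr_ae
    filter_upwards [hg, hgx', ae_restrict_mem isOpen_phase.measurableSet] with p h1 h2 h3
    have hx : p.1 ∈ Icc (0 : ℝ) 1 := ⟨h3.1.1.le, h3.1.2.le⟩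
    have hd : fderiv ℝ φ p (1, 0) = deriv e p.1 * ψ p.2 := by
      rw [show p = (p.1, p.2) from rfl, fderiv_one_zero_eq_deriv (hφs.differentiable (by simp))]
      have : (fun y => φ (y, p.2)) =ᶠ[𝓝 p.1] fun y => e y * ψ p.2 := by
        filter_upwards [hχ1 p.1 hx] with y hy
        simp only [hφ, hy, Pi.one_apply, mul_one]
      rw [this.deriv_eq, deriv_mul_const (he.differentiable (by simp) _)]
    rw [hd, h1, ← h2]
    simp only [hφ, hχ p.1 hx]
    ring
  have hψ : 0 < ∫ v, maxwellian v * ψ v := by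
    have hc : Continuous fun v => maxwellian v * ψ v := continuous_maxwellian.mul ψ.continuous
    apply hc.integral_pos_of_hasCompactSupport_nonneg_nonzero ψ.hasCompactSupport.mul_left
      (fun v => mul_nonneg (maxwellian_pos v).le ψ.nonneg) (x := 0)
    have : ψ (0 : ℝ) = 1 := ψ.one_of_mem_closedBall (by simp [ψ])
    rw [this, mul_one]
    exact (maxwellian_pos 0).ne'
  rw [hL, volume_restrict_phase, integral_prod_mul (fun x => s x * deriv e x + s' x * e x)
    (fun v => maxwellian v * ψ v)] at hG
  have hz := (mul_eq_zero.1 hG).resolve_right hψ.ne'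
  have i1 := (memLp_mul_continuousOn m1
    (he.continuous_deriv (by simp)).continuousOn).integrable one_le_two
  have i2 := (memLp_mul_continuousOn m2 he.continuous.continuousOn).integrable one_le_two
  rw [integral_add i1 i2] at hz
  linarith

theorem integral_eq_zero_of_mass {s : ℝ → ℝ} {g : ℝ × ℝ → ℝ}
    (hg : ∀ᵐ p ∂(volume.restrict phase), g p = s p.1 * maxwellian p.2)
    (hm : ∫ p in phase, g p = 0) : ∫ x in Ioo (0 : ℝ) 1, s x = 0 := by
  rw [integral_congr_ae hg, volume_restrict_phase, integral_prod_mul s maxwellian,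
    maxwellian_eq_gaussianPDFReal, ProbabilityTheory.integral_gaussianPDFReal_eq_one 0 one_ne_zero,
    mul_one] at hm
  exact hm

theorem isTestFunction_tensor {θ e : ℝ → ℝ} (h1 : ContDiff ℝ ∞ θ) (h2 : HasCompactSupport θ)
    (h3 : tsupport θ ⊆ Ioi 0) (he : ContDiff ℝ ∞ e) (hper : e 0 = e 1) :
    IsTestFunction !![0, 1; 1, 0] (fun p => θ p.1 * e p.2) where
  smooth := (h1.comp contDiff_fst).mul (he.comp contDiff_snd)
  support := by
    rcases (tsupport θ).eq_empty_or_nonempty with hem | hne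
    · refine ⟨1, 1, one_pos, fun t x _ => ?_⟩
      have : θ t = 0 := image_eq_zero_of_notMem_tsupport (by simp [hem])
      simp [this]
    · obtain ⟨x, hx, hxm⟩ := h2.isCompact.exists_isMinOn hne continuousOn_id
      obtain ⟨y, hy, hym⟩ := h2.isCompact.exists_isMaxOn hne continuousOn_id
      refine ⟨x, y, h3 hx, fun t z ht => ?_⟩
      have : θ t = 0 := image_eq_zero_of_notMem_tsupport fun hh => ht ⟨hxm hh, hym hh⟩
      simp [this]
  -- For this matrix the limit boundary condition is `p = q`, so equal end values of `e` suffice.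
  boundary := by
    intro p q hp _ t
    have : p = q := by simpa using hp
    simp [this, hper]

/-- A `C¹` function with equal end values is a `C¹` limit of smooth functions with equal end
values. -/
theorem exists_smooth_periodic_near {u u' : ℝ → ℝ}
    (hu : ∀ x ∈ Icc (0 : ℝ) 1, HasDerivWithinAt u (u' x) (Icc 0 1) x)
    (hu' : ContinuousOn u' (Icc 0 1)) (hper : u 0 = u 1) {ε : ℝ} (hε : 0 < ε) :
    ∃ U : ℝ → ℝ, ContDiff ℝ ∞ U ∧ U 0 = U 1 ∧ (∀ x ∈ Icc (0 : ℝ) 1, |u x - U x| ≤ 2 * ε) ∧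
      ∀ x ∈ Icc (0 : ℝ) 1, |u' x - deriv U x| ≤ 2 * ε := by
  obtain ⟨p, hp⟩ := exists_polynomial_near_of_continuousOn 0 1 u' hu' ε hε
  set Q : ℝ → ℝ := fun x => ∫ y in (0 : ℝ)..x, p.eval y with hQ
  have hQd : ∀ x, HasDerivAt Q (p.eval x) x := fun x =>
    intervalIntegral.integral_hasDerivAt_right (p.continuous.intervalIntegrable _ _)
      p.continuous.stronglyMeasurable.stronglyMeasurableAtFilter p.continuous.continuousAt
  have hQ0 : Q 0 = 0 := by simp [hQ]
  have h0 : (0 : ℝ) ∈ Icc (0 : ℝ) 1 := by simp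
  have h1 : (1 : ℝ) ∈ Icc (0 : ℝ) 1 := by simp
  have hI : |Q 1| ≤ ε := by
    have := (convex_Icc (0 : ℝ) 1).norm_image_sub_le_of_norm_hasDerivWithin_le
      (f := fun x => Q x - u x) (f' := fun x => p.eval x - u' x) (C := ε)
      (fun x hx => (hQd x).hasDerivWithinAt.sub (hu x hx)) (fun x hx => (hp x hx).le) h0 h1
    simpa [hQ0, hper] using this
  -- The primitive `Q` of the polynomial misses periodicity by `Q 1`, which is at most `ε` because
  -- `u 0 = u 1`. The linear correction restores it and costs a second `ε` in the derivative.
  set U : ℝ → ℝ := fun x => u 0 + (Q x - x * Q 1) with hU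
  have hUd : ∀ x, HasDerivAt U (p.eval x - Q 1) x := fun x => by
    have := ((hQd x).sub ((hasDerivAt_id x).mul_const (Q 1))).const_add (u 0)
    rw [one_mul] at this
    exact this
  have hUd' : deriv U = fun x => p.eval x - Q 1 := funext fun x => (hUd x).deriv
  have hb : ∀ x ∈ Icc (0 : ℝ) 1, |u' x - (p.eval x - Q 1)| ≤ 2 * ε := by
    intro x hx
    have := hp x hx
    rw [abs_lt] at this
    rw [abs_le] at hI ⊢
    constructor <;> linarith
  refine ⟨U, ?_, by simp [hU, hQ0], ?_, ?_⟩
  · rw [contDiff_infty_iff_deriv, hUd']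
    exact ⟨fun x => (hUd x).differentiableAt, (by simpa using p.contDiff_aeval (𝕜 := ℝ) ∞ : ContDiff ℝ ∞ fun x => p.eval x).sub contDiff_const⟩
  · intro x hx
    have := (convex_Icc (0 : ℝ) 1).norm_image_sub_le_of_norm_hasDerivWithin_le
      (f := fun x => u x - U x) (f' := fun x => u' x - (p.eval x - Q 1)) (C := 2 * ε)
      (fun x hx => (hu x hx).sub (hUd x).hasDerivWithinAt) hb h0 hx
    have hU0 : u 0 - U 0 = 0 := by simp [hU, hQ0]
    rw [hU0, sub_zero, sub_zero, Real.norm_eq_abs, Real.norm_eq_abs, abs_of_nonneg hx.1] at this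
    refine this.trans (mul_le_of_le_one_right (by positivity) hx.2)
  · intro x hx
    rw [hUd']
    exact hb x hx

theorem integral_mul_le_of_abs_le {s u : ℝ → ℝ} (hs : MemLp s 2 (volume.restrict (Ioo 0 1)))
    {ε : ℝ} (hu : ∀ x ∈ Icc (0 : ℝ) 1, |u x| ≤ ε) :
    |∫ x in Ioo (0 : ℝ) 1, s x * u x| ≤ ε * ∫ x in Ioo (0 : ℝ) 1, |s x| := by
  rw [← integral_const_mul]
  rw [← Real.norm_eq_abs]
  refine norm_integral_le_of_norm_le ((hs.integrable one_le_two).abs.const_mul ε) ?_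
  filter_upwards [ae_restrict_mem measurableSet_Ioo] with x hx
  rw [norm_mul, mul_comm]
  exact mul_le_mul_of_nonneg_right (hu x (Ioo_subset_Icc_self hx)) (norm_nonneg _)

/-- Integration by parts against smooth functions with equal end values extends to `C¹`. -/
theorem integral_periodic_C1 {s s' u u' : ℝ → ℝ} (m1 : MemLp s 2 (volume.restrict (Ioo 0 1)))
    (m2 : MemLp s' 2 (volume.restrict (Ioo 0 1)))
    (hP : ∀ e : ℝ → ℝ, ContDiff ℝ ∞ e → e 0 = e 1 →
      ∫ x in Ioo (0 : ℝ) 1, s' x * e x = - ∫ x in Ioo (0 : ℝ) 1, s x * deriv e x)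
    (hu : ∀ x ∈ Icc (0 : ℝ) 1, HasDerivWithinAt u (u' x) (Icc 0 1) x)
    (hu' : ContinuousOn u' (Icc 0 1)) (hper : u 0 = u 1) :
    ∫ x in Ioo (0 : ℝ) 1, s' x * u x = - ∫ x in Ioo (0 : ℝ) 1, s x * u' x := by
  have huc : ContinuousOn u (Icc 0 1) := fun x hx => (hu x hx).continuousWithinAt
  set K := (∫ x in Ioo (0 : ℝ) 1, |s' x|) + ∫ x in Ioo (0 : ℝ) 1, |s x| with hK
  have hK0 : 0 ≤ K := by positivity
  have key : ∀ ε > 0, |(∫ x in Ioo (0 : ℝ) 1, s' x * u x) + ∫ x in Ioo (0 : ℝ) 1, s x * u' x|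
      ≤ 2 * ε * K := by
    intro ε hε
    obtain ⟨U, hU, hU01, hb, hb'⟩ := exists_smooth_periodic_near hu hu' hper hε
    have hUc := hU.continuous
    have hUc' : Continuous (deriv U) := hU.continuous_deriv (by simp)
    have e1 : ∫ x in Ioo (0 : ℝ) 1, s' x * (u x - U x)
        = (∫ x in Ioo (0 : ℝ) 1, s' x * u x) - ∫ x in Ioo (0 : ℝ) 1, s' x * U x := by
      simp only [mul_sub]
      exact integral_sub ((memLp_mul_continuousOn m2 huc).integrable one_le_two)
        ((memLp_mul_continuousOn m2 hUc.continuousOn).integrable one_le_two)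
    have e2 : ∫ x in Ioo (0 : ℝ) 1, s x * (u' x - deriv U x)
        = (∫ x in Ioo (0 : ℝ) 1, s x * u' x) - ∫ x in Ioo (0 : ℝ) 1, s x * deriv U x := by
      simp only [mul_sub]
      exact integral_sub ((memLp_mul_continuousOn m1 hu').integrable one_le_two)
        ((memLp_mul_continuousOn m1 hUc'.continuousOn).integrable one_le_two)
    have e3 : (∫ x in Ioo (0 : ℝ) 1, s' x * u x) + ∫ x in Ioo (0 : ℝ) 1, s x * u' x
        = (∫ x in Ioo (0 : ℝ) 1, s' x * (u x - U x))
          + ∫ x in Ioo (0 : ℝ) 1, s x * (u' x - deriv U x) := by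
      rw [e1, e2, hP U hU hU01]; ring
    rw [e3, hK, mul_add]
    exact (abs_add_le _ _).trans
      (add_le_add (integral_mul_le_of_abs_le m2 hb) (integral_mul_le_of_abs_le m1 hb'))
  have hz : |(∫ x in Ioo (0 : ℝ) 1, s' x * u x) + ∫ x in Ioo (0 : ℝ) 1, s x * u' x| ≤ 0 := by
    refine le_of_forall_pos_le_add fun δ hδ => ?_
    refine (key (δ / (2 * (K + 1))) (by positivity)).trans ?_
    rw [zero_add, show 2 * (δ / (2 * (K + 1))) * K = δ * (K / (K + 1)) by field_simp]
    refine mul_le_of_le_one_right hδ.le ?_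
    rw [div_le_one (by positivity)]
    linarith
  linarith [abs_nonpos_iff.1 hz]

/-! ### Fourier coefficients and Parseval's identity -/

/-- The `k`-th angular frequency of `1`-periodic functions. -/
noncomputable def freq (k : ℤ) : ℝ := 2 * Real.pi * k

noncomputable def cosCoeff (s : ℝ → ℝ) (k : ℤ) : ℝ :=
  ∫ x in Ioo (0 : ℝ) 1, s x * Real.cos (freq k * x)

noncomputable def sinCoeff (s : ℝ → ℝ) (k : ℤ) : ℝ :=
  ∫ x in Ioo (0 : ℝ) 1, s x * Real.sin (freq k * x)

theorem cos_freq (k : ℤ) : Real.cos (freq k) = 1 := by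
  rw [freq, mul_comm]; exact Real.cos_int_mul_two_pi k

theorem sin_freq (k : ℤ) : Real.sin (freq k) = 0 := by
  have := Real.sin_int_mul_pi (2 * k)
  rw [freq, ← this]; push_cast; congr 1; ring

/-- The spectral gap on mean-zero periodic functions, `(2π)²`, bounded below using only `π > 3`. -/
theorem le_freq_sq {k : ℤ} (hk : k ≠ 0) : 36 ≤ freq k ^ 2 := by
  have h1 : (1 : ℝ) ≤ (k : ℝ) ^ 2 := by
    have : (1 : ℤ) ≤ k ^ 2 := by
      have := sq_pos_of_ne_zero hk
      omega
    exact_mod_cast this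
  have h2 : (9 : ℝ) ≤ Real.pi ^ 2 := by nlinarith [Real.pi_gt_three]
  rw [freq, mul_pow, mul_pow]
  nlinarith

theorem contDiff_cos_freq (k : ℤ) : ContDiff ℝ ∞ fun x => Real.cos (freq k * x) :=
  Real.contDiff_cos.comp (contDiff_const.mul contDiff_id)

theorem contDiff_sin_freq (k : ℤ) : ContDiff ℝ ∞ fun x => Real.sin (freq k * x) :=
  Real.contDiff_sin.comp (contDiff_const.mul contDiff_id)

theorem deriv_cos_freq (k : ℤ) :
    deriv (fun x => Real.cos (freq k * x)) = fun x => -freq k * Real.sin (freq k * x) := by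
  ext x
  have : HasDerivAt (fun x : ℝ => freq k * x) (freq k) x := by
    simpa using (hasDerivAt_id x).const_mul (freq k)
  rw [this.cos.deriv]; ring

theorem deriv_sin_freq (k : ℤ) :
    deriv (fun x => Real.sin (freq k * x)) = fun x => freq k * Real.cos (freq k * x) := by
  ext x
  have : HasDerivAt (fun x : ℝ => freq k * x) (freq k) x := by
    simpa using (hasDerivAt_id x).const_mul (freq k)
  rw [this.sin.deriv]; ring

theorem fourierCoeffOn_ofReal {s : ℝ → ℝ} (hs : MemLp s 2 (volume.restrict (Ioo 0 1))) (k : ℤ) :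
    fourierCoeffOn (zero_lt_one' ℝ) (fun x => (s x : ℂ)) k
      = (cosCoeff s k : ℂ) - (sinCoeff s k : ℂ) * Complex.I := by
  have i1 := (memLp_mul_continuousOn hs
    (contDiff_cos_freq k).continuous.continuousOn).integrable one_le_two
  have i2 := (memLp_mul_continuousOn hs
    (contDiff_sin_freq k).continuous.continuousOn).integrable one_le_two
  rw [fourierCoeffOn_eq_integral, intervalIntegral.integral_of_le zero_le_one,
    integral_Ioc_eq_integral_Ioo, cosCoeff, sinCoeff, ← integral_complex_ofReal,
    ← integral_complex_ofReal, ← integral_mul_const, ← integral_sub i1.ofReal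
      (i2.ofReal.mul_const _)]
  simp only [sub_zero, div_one, one_smul]
  congr 1
  ext x
  rw [fourier_coe_apply, smul_eq_mul]
  have : 2 * (Real.pi : ℂ) * Complex.I * ((-k : ℤ) : ℂ) * (x : ℂ) / ((1 - 0 : ℝ) : ℂ)
      = ((-(freq k * x) : ℝ) : ℂ) * Complex.I := by
    simp only [freq]; push_cast; ring
  rw [this, Complex.exp_mul_I, ← Complex.ofReal_cos, ← Complex.ofReal_sin, Real.cos_neg,
    Real.sin_neg]
  push_cast
  ring

/-- For real `s` the cosine and sine coefficients are, up to sign, the real and imaginary parts of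
the complex one. The sum is over all of `ℤ`, so no factor `2` appears. -/
theorem hasSum_parseval {s : ℝ → ℝ} (hs : MemLp s 2 (volume.restrict (Ioo 0 1))) :
    HasSum (fun k : ℤ => cosCoeff s k ^ 2 + sinCoeff s k ^ 2) (∫ x in Ioo (0 : ℝ) 1, s x ^ 2) := by
  have hs' : MemLp (fun x => (s x : ℂ)) 2 (volume.restrict (Ioc 0 1)) := by
    rw [← restrict_Ioo_eq_restrict_Ioc]; exact hs.ofReal
  have h := hasSum_sq_fourierCoeffOn (zero_lt_one' ℝ) hs'
  rw [intervalIntegral.integral_of_le zero_le_one, integral_Ioc_eq_integral_Ioo] at h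
  convert h using 1
  · ext k
    rw [fourierCoeffOn_ofReal hs, ← Complex.normSq_eq_norm_sq, Complex.normSq_apply]
    simp
    ring
  · simp

/-- Weak periodicity allows integration by parts against `cos` and `sin` without boundary terms. The
coefficients of `s'` are then those of `s`, exchanged and multiplied by `± freq k`. -/
theorem hasSum_parseval_H1 {s s' : ℝ → ℝ} (m1 : MemLp s 2 (volume.restrict (Ioo 0 1)))
    (m2 : MemLp s' 2 (volume.restrict (Ioo 0 1)))
    (hP : ∀ e : ℝ → ℝ, ContDiff ℝ ∞ e → e 0 = e 1 →
      ∫ x in Ioo (0 : ℝ) 1, s' x * e x = - ∫ x in Ioo (0 : ℝ) 1, s x * deriv e x) :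
    HasSum (fun k : ℤ => (1 + freq k ^ 2) * cosCoeff s k ^ 2
        + (1 + freq k ^ 2) * sinCoeff s k ^ 2)
      ((∫ x in Ioo (0 : ℝ) 1, s x ^ 2) + ∫ x in Ioo (0 : ℝ) 1, s' x ^ 2) := by
  convert (hasSum_parseval m1).add (hasSum_parseval m2) using 1
  ext k
  have h1 : cosCoeff s' k = freq k * sinCoeff s k := by
    rw [cosCoeff, hP _ (contDiff_cos_freq k) (by simp [cos_freq]), deriv_cos_freq, sinCoeff,
      ← integral_const_mul, ← integral_neg]
    congr 1; ext x; ring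
  have h2 : sinCoeff s' k = -(freq k * cosCoeff s k) := by
    rw [sinCoeff, hP _ (contDiff_sin_freq k) (by simp [sin_freq]), deriv_sin_freq, cosCoeff,
      ← integral_const_mul]
    congr 2; ext x; ring
  rw [h1, h2]; ring

/-- The variance of `|s|` on the unit interval is nonnegative. -/
theorem sq_integral_abs_le {s : ℝ → ℝ} (hs : MemLp s 2 (volume.restrict (Ioo 0 1))) :
    (∫ x in Ioo (0 : ℝ) 1, |s x|) ^ 2 ≤ ∫ x in Ioo (0 : ℝ) 1, s x ^ 2 := by
  set m := ∫ x in Ioo (0 : ℝ) 1, |s x| with hm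
  have i1 := (hs.integrable one_le_two).abs
  have i2 := hs.integrable_sq
  have h0 : 0 ≤ ∫ x in Ioo (0 : ℝ) 1, (|s x| - m) ^ 2 := by positivity
  have e : ∀ x, (|s x| - m) ^ 2 = s x ^ 2 - (2 * m * |s x| - m ^ 2) := fun x => by
    rw [sub_sq, sq_abs]; ring
  have i3 : Integrable (fun _ : ℝ => m ^ 2) (volume.restrict (Ioo (0 : ℝ) 1)) :=
    integrable_const _
  simp only [e] at h0
  have i4 : Integrable (fun x => 2 * m * |s x| - m ^ 2) (volume.restrict (Ioo (0 : ℝ) 1)) :=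
    (i1.const_mul _).sub i3
  rw [integral_sub i2 i4, integral_sub (i1.const_mul _) i3, integral_const_mul, ← hm] at h0
  simp at h0
  linarith

theorem energy_eq_ofReal {s s' : ℝ → ℝ} (m1 : MemLp s 2 (volume.restrict (Ioo 0 1)))
    (m2 : MemLp s' 2 (volume.restrict (Ioo 0 1))) :
    energy s s' = ENNReal.ofReal
      ((∫ x in Ioo (0 : ℝ) 1, s x ^ 2) + ∫ x in Ioo (0 : ℝ) 1, s' x ^ 2) := by
  have key : ∀ r : ℝ → ℝ, MemLp r 2 (volume.restrict (Ioo 0 1)) →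
      ∫⁻ x in Ioo (0 : ℝ) 1, ‖r x‖ₑ ^ 2 = ENNReal.ofReal (∫ x in Ioo (0 : ℝ) 1, r x ^ 2) := by
    intro r hr
    rw [ofReal_integral_eq_lintegral_ofReal hr.integrable_sq
      (Eventually.of_forall fun x => sq_nonneg _)]
    congr 1; ext x
    rw [← enorm_pow, Real.enorm_of_nonneg (sq_nonneg _)]
  rw [energy, key s m1, key s' m2, ENNReal.ofReal_add (by positivity) (by positivity)]

/-! ### The density as a flow in `H¹(0,1)` and its moments -/

/-- The properties of the density of a limit solution with periodic boundary conditions that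
determine its decay. -/
structure IsPeriodicFlow (E s sx : ℝ → ℝ → ℝ) : Prop where
  weakDeriv : ∀ t, 0 ≤ t → HasWeakDeriv (s t) (sx t)
  energy_lt_top : ∀ t, 0 ≤ t → energy (s t) (sx t) < ⊤
  continuous : ∀ t₀, 0 ≤ t₀ →
    Tendsto (fun t => energy (fun x => s t x - s t₀ x) (fun x => sx t x - sx t₀ x))
      (𝓝[Ici 0] t₀) (𝓝 0)
  periodic : ∀ t, 0 ≤ t → ∀ e : ℝ → ℝ, ContDiff ℝ ∞ e → e 0 = e 1 →
    ∫ x in Ioo (0 : ℝ) 1, sx t x * e x = - ∫ x in Ioo (0 : ℝ) 1, s t x * deriv e x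
  equation : ∀ e : ℝ → ℝ, ContDiff ℝ ∞ e → e 0 = e 1 → ∀ θ : ℝ → ℝ, ContDiff ℝ ∞ θ →
    HasCompactSupport θ → tsupport θ ⊆ Ioi 0 →
    ∫ t in Ioi (0 : ℝ), (deriv θ t * (∫ x in Ioo (0 : ℝ) 1, s t x * e x)
      - θ t * ∫ x in Ioo (0 : ℝ) 1, (sx t x + E t x * s t x) * deriv e x) = 0
  mass : ∫ x in Ioo (0 : ℝ) 1, s 0 x = 0

namespace FieldAssumption

variable {Cs CE : ℝ} {E : ℝ → ℝ → ℝ}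

theorem continuousOn_apply (hE : FieldAssumption Cs CE E) {t : ℝ} (ht : 0 ≤ t) :
    ContinuousOn (E t) (Icc 0 1) := (hE.smooth t ht).continuousOn

theorem hasDerivWithinAt (hE : FieldAssumption Cs CE E) {t : ℝ} (ht : 0 ≤ t) {x : ℝ}
    (hx : x ∈ Icc (0 : ℝ) 1) :
    HasDerivWithinAt (E t) (derivWithin (E t) (Icc 0 1) x) (Icc 0 1) x :=
  ((hE.smooth t ht).differentiableOn (by norm_num) x hx).hasDerivWithinAt

theorem continuousOn_derivWithin (hE : FieldAssumption Cs CE E) {t : ℝ} (ht : 0 ≤ t) :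
    ContinuousOn (derivWithin (E t) (Icc 0 1)) (Icc 0 1) :=
  (hE.smooth t ht).continuousOn_derivWithin (uniqueDiffOn_Icc zero_lt_one) (by norm_num)

theorem abs_derivWithin_le (hE : FieldAssumption Cs CE E) {t : ℝ} (ht : 0 ≤ t) {x : ℝ}
    (hx : x ∈ Icc (0 : ℝ) 1) : |derivWithin (E t) (Icc 0 1) x| ≤ CE / 2 := by
  have := hE.bound_deriv t ht x hx
  rwa [iteratedDerivWithin_one] at this

theorem nonneg (hE : FieldAssumption Cs CE E) : 0 ≤ CE := by
  have := (abs_nonneg _).trans (hE.bound 0 le_rfl 0 (by simp))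
  linarith

end FieldAssumption

namespace IsPeriodicFlow

variable {Cs CE : ℝ} {E s sx : ℝ → ℝ → ℝ}

theorem memLp (h : IsPeriodicFlow E s sx) {t : ℝ} (ht : 0 ≤ t) :
    MemLp (s t) 2 (volume.restrict (Ioo 0 1)) :=
  ((h.weakDeriv t ht).memLp (h.energy_lt_top t ht)).1

theorem memLp_deriv (h : IsPeriodicFlow E s sx) {t : ℝ} (ht : 0 ≤ t) :
    MemLp (sx t) 2 (volume.restrict (Ioo 0 1)) :=
  ((h.weakDeriv t ht).memLp (h.energy_lt_top t ht)).2

theorem memLp_drift (h : IsPeriodicFlow E s sx) (hE : FieldAssumption Cs CE E) {t : ℝ}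
    (ht : 0 ≤ t) : MemLp (fun x => E t x * s t x) 2 (volume.restrict (Ioo 0 1)) := by
  simpa only [mul_comm] using memLp_mul_continuousOn (h.memLp ht) (hE.continuousOn_apply ht)

theorem tendsto_sq_sub (h : IsPeriodicFlow E s sx) {t₀ : ℝ} (ht₀ : 0 ≤ t₀) :
    Tendsto (fun t => (∫ x in Ioo (0 : ℝ) 1, (s t x - s t₀ x) ^ 2)
      + ∫ x in Ioo (0 : ℝ) 1, (sx t x - sx t₀ x) ^ 2) (𝓝[Ici 0] t₀) (𝓝 0) := by
  have h1 := (ENNReal.tendsto_toReal ENNReal.zero_ne_top).comp (h.continuous t₀ ht₀)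
  refine h1.congr' ?_
  filter_upwards [self_mem_nhdsWithin] with t ht
  have m1 : MemLp (fun x => s t x - s t₀ x) 2 (volume.restrict (Ioo 0 1)) :=
    (h.memLp ht).sub (h.memLp ht₀)
  have m2 : MemLp (fun x => sx t x - sx t₀ x) 2 (volume.restrict (Ioo 0 1)) :=
    (h.memLp_deriv ht).sub (h.memLp_deriv ht₀)
  simp only [Function.comp]
  rw [energy_eq_ofReal m1 m2, ENNReal.toReal_ofReal (by positivity)]

theorem tendsto_abs_sub (h : IsPeriodicFlow E s sx) {t₀ : ℝ} (ht₀ : 0 ≤ t₀) :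
    Tendsto (fun t => ∫ x in Ioo (0 : ℝ) 1, |s t x - s t₀ x|) (𝓝[Ici 0] t₀) (𝓝 0) := by
  have h1 := (h.tendsto_sq_sub ht₀).sqrt
  rw [Real.sqrt_zero] at h1
  refine tendsto_of_tendsto_of_tendsto_of_le_of_le' tendsto_const_nhds h1
    (Eventually.of_forall fun _ => by positivity) ?_
  filter_upwards [self_mem_nhdsWithin] with t ht
  apply Real.le_sqrt_of_sq_le
  refine (sq_integral_abs_le ((h.memLp ht).sub (h.memLp ht₀))).trans ?_
  exact le_add_of_nonneg_right (by positivity)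

theorem tendsto_abs_sub_deriv (h : IsPeriodicFlow E s sx) {t₀ : ℝ} (ht₀ : 0 ≤ t₀) :
    Tendsto (fun t => ∫ x in Ioo (0 : ℝ) 1, |sx t x - sx t₀ x|) (𝓝[Ici 0] t₀) (𝓝 0) := by
  have h1 := (h.tendsto_sq_sub ht₀).sqrt
  rw [Real.sqrt_zero] at h1
  refine tendsto_of_tendsto_of_tendsto_of_le_of_le' tendsto_const_nhds h1
    (Eventually.of_forall fun _ => by positivity) ?_
  filter_upwards [self_mem_nhdsWithin] with t ht
  apply Real.le_sqrt_of_sq_le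
  refine (sq_integral_abs_le ((h.memLp_deriv ht).sub (h.memLp_deriv ht₀))).trans ?_
  exact le_add_of_nonneg_left (by positivity)

/-- Convergence in `L¹` implies convergence of the integrals against bounded functions. -/
theorem tendsto_integral_mul {r : ℝ → ℝ → ℝ} {u : ℝ → ℝ → ℝ} {t₀ C : ℝ}
    (hr : ∀ t, 0 ≤ t → MemLp (r t) 2 (volume.restrict (Ioo 0 1)))
    (hu : ∀ t, 0 ≤ t → ContinuousOn (u t) (Icc 0 1))
    (hb : ∀ t, 0 ≤ t → ∀ x ∈ Icc (0 : ℝ) 1, |u t x| ≤ C)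
    (ht₀ : 0 ≤ t₀)
    (hlim : ∀ x ∈ Icc (0 : ℝ) 1, Tendsto (fun t => u t x) (𝓝[Ici 0] t₀) (𝓝 (u t₀ x)))
    (h : Tendsto (fun t => ∫ x in Ioo (0 : ℝ) 1, |r t x - r t₀ x|) (𝓝[Ici 0] t₀) (𝓝 0)) :
    Tendsto (fun t => ∫ x in Ioo (0 : ℝ) 1, r t x * u t x) (𝓝[Ici 0] t₀)
      (𝓝 (∫ x in Ioo (0 : ℝ) 1, r t₀ x * u t₀ x)) := by
  have l1 : Tendsto (fun t => ∫ x in Ioo (0 : ℝ) 1, (r t x - r t₀ x) * u t x)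
      (𝓝[Ici 0] t₀) (𝓝 0) := by
    rw [tendsto_zero_iff_abs_tendsto_zero]
    have h2 := h.const_mul C
    rw [mul_zero] at h2
    refine tendsto_of_tendsto_of_tendsto_of_le_of_le' tendsto_const_nhds h2
      (Eventually.of_forall fun _ => abs_nonneg _) ?_
    filter_upwards [self_mem_nhdsWithin] with t ht
    exact integral_mul_le_of_abs_le ((hr t ht).sub (hr t₀ ht₀)) (hb t ht)
  have l2 : Tendsto (fun t => ∫ x in Ioo (0 : ℝ) 1, r t₀ x * u t x) (𝓝[Ici 0] t₀)
      (𝓝 (∫ x in Ioo (0 : ℝ) 1, r t₀ x * u t₀ x)) := by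
    refine tendsto_integral_filter_of_dominated_convergence (fun x => C * |r t₀ x|) ?_ ?_ ?_ ?_
    · filter_upwards [self_mem_nhdsWithin] with t ht
      exact (memLp_mul_continuousOn (hr t₀ ht₀) (hu t ht)).1
    · filter_upwards [self_mem_nhdsWithin] with t ht
      filter_upwards [ae_restrict_mem measurableSet_Ioo] with x hx
      rw [norm_mul, mul_comm]
      exact mul_le_mul_of_nonneg_right (hb t ht x (Ioo_subset_Icc_self hx)) (norm_nonneg _)
    · exact ((hr t₀ ht₀).integrable one_le_two).abs.const_mul C
    · filter_upwards [ae_restrict_mem measurableSet_Ioo] with x hx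
      exact (hlim x (Ioo_subset_Icc_self hx)).const_mul _
  have l3 := l1.add l2
  rw [zero_add] at l3
  refine l3.congr' ?_
  filter_upwards [self_mem_nhdsWithin] with t ht
  have m : MemLp (fun x => r t x - r t₀ x) 2 (volume.restrict (Ioo 0 1)) :=
    (hr t ht).sub (hr t₀ ht₀)
  rw [← integral_add ((memLp_mul_continuousOn m (hu t ht)).integrable
    one_le_two) ((memLp_mul_continuousOn (hr t₀ ht₀) (hu t ht)).integrable one_le_two)]
  congr 1; ext x
  ring

theorem continuousOn_integral_mul (h : IsPeriodicFlow E s sx) {e : ℝ → ℝ} (he : Continuous e) :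
    ContinuousOn (fun t => ∫ x in Ioo (0 : ℝ) 1, s t x * e x) (Ici 0) := by
  intro t₀ ht₀
  obtain ⟨C, hC⟩ := isCompact_Icc.exists_bound_of_continuousOn (he.continuousOn (s := Icc 0 1))
  exact tendsto_integral_mul (u := fun _ => e) (fun t ht => h.memLp ht)
    (fun _ _ => he.continuousOn) (fun _ _ => hC) ht₀ (fun x _ => tendsto_const_nhds)
    (h.tendsto_abs_sub ht₀)

/-- This continuity is what upgrades the weak equation for a moment to a classical ODE. Joint
continuity of `E` supplies the pointwise limit in the drift term. -/
theorem continuousOn_integral_flux_mul (h : IsPeriodicFlow E s sx) (hE : FieldAssumption Cs CE E)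
    {e : ℝ → ℝ} (he : Continuous e) :
    ContinuousOn (fun t => ∫ x in Ioo (0 : ℝ) 1, (sx t x + E t x * s t x) * e x) (Ici 0) := by
  intro t₀ ht₀
  obtain ⟨C, hC⟩ := isCompact_Icc.exists_bound_of_continuousOn (he.continuousOn (s := Icc 0 1))
  have l1 := tendsto_integral_mul (u := fun _ => e) (fun t ht => h.memLp_deriv ht)
    (fun _ _ => he.continuousOn) (fun _ _ => hC) ht₀ (fun x _ => tendsto_const_nhds)
    (h.tendsto_abs_sub_deriv ht₀)
  have l2 := tendsto_integral_mul (u := fun t x => E t x * e x) (C := CE / 2 * C)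
    (fun t ht => h.memLp ht)
    (fun t ht => (hE.continuousOn_apply ht).mul he.continuousOn)
    (fun t ht x hx => by
      rw [abs_mul]
      exact mul_le_mul (hE.bound t ht x hx) (hC x hx) (abs_nonneg _)
        ((abs_nonneg _).trans (hE.bound t ht x hx))) ht₀
    (fun x hx => by
      refine Tendsto.mul_const _ ?_
      have h1 : ContinuousWithinAt (fun p : ℝ × ℝ => E p.1 p.2) (Ici 0 ×ˢ Icc 0 1) (t₀, x) :=
        hE.continuous (t₀, x) ⟨ht₀, hx⟩
      have h2 : ContinuousWithinAt (fun t : ℝ => (t, x)) (Ici 0) t₀ :=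
        (Continuous.prodMk continuous_id continuous_const).continuousWithinAt
      exact h1.comp (f := fun t : ℝ => (t, x)) h2 fun t ht => ⟨ht, hx⟩) (h.tendsto_abs_sub ht₀)
  have l3 := l1.add l2
  have key : ∀ t, 0 ≤ t → (∫ x in Ioo (0 : ℝ) 1, sx t x * e x)
      + (∫ x in Ioo (0 : ℝ) 1, s t x * (E t x * e x))
      = ∫ x in Ioo (0 : ℝ) 1, (sx t x + E t x * s t x) * e x := fun t ht => by
    have j1 := (memLp_mul_continuousOn (h.memLp_deriv ht) he.continuousOn).integrable one_le_two
    have j2 : Integrable (fun x => s t x * (E t x * e x)) (volume.restrict (Ioo 0 1)) :=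
      (memLp_mul_continuousOn (h.memLp ht)
        ((hE.continuousOn_apply ht).mul he.continuousOn)).integrable one_le_two
    rw [← integral_add j1 j2]
    congr 1; ext x; ring
  rw [key t₀ ht₀] at l3
  refine l3.congr' ?_
  filter_upwards [self_mem_nhdsWithin] with t ht using key t ht

theorem hasDerivAt_integral_mul (h : IsPeriodicFlow E s sx) (hE : FieldAssumption Cs CE E)
    {e : ℝ → ℝ} (he : ContDiff ℝ ∞ e) (hper : e 0 = e 1) {t : ℝ} (ht : 0 < t) :
    HasDerivAt (fun t => ∫ x in Ioo (0 : ℝ) 1, s t x * e x)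
      (-∫ x in Ioo (0 : ℝ) 1, (sx t x + E t x * s t x) * deriv e x) t := by
  -- Composing with `max t 0` extends the moments continuously to all of `ℝ` without changing them
  -- for `t ≥ 0`.
  have hmax : Continuous fun t : ℝ => max t 0 := by fun_prop
  have c1 := (h.continuousOn_integral_mul he.continuous).comp_continuous hmax
    fun t => le_max_right t 0
  have c2 := (h.continuousOn_integral_flux_mul hE (he.continuous_deriv (by simp))).comp_continuous
    hmax fun t => le_max_right t 0
  have key := hasDerivAt_of_integral_test c1 c2 (fun θ h1 h2 h3 => by
    refine Eq.trans ?_ (h.equation e he hper θ h1 h2 h3)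
    refine setIntegral_congr_fun measurableSet_Ioi fun r hr => ?_
    have hr0 : (0 : ℝ) ≤ r := le_of_lt hr
    simp only [Function.comp, max_eq_left hr0]) t ht
  simp only [Function.comp, max_eq_left ht.le] at key
  refine key.congr_of_eventuallyEq ?_
  filter_upwards [Ioi_mem_nhds ht] with r hr
  have hr0 : (0 : ℝ) ≤ r := le_of_lt hr
  simp only [Function.comp, max_eq_left hr0]

/-- The derivative `∂ₓ(E s)`. -/
noncomputable def driftDeriv (E s sx : ℝ → ℝ → ℝ) (t x : ℝ) : ℝ :=
  derivWithin (E t) (Icc 0 1) x * s t x + E t x * sx t x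

theorem memLp_driftDeriv (h : IsPeriodicFlow E s sx) (hE : FieldAssumption Cs CE E) {t : ℝ}
    (ht : 0 ≤ t) : MemLp (driftDeriv E s sx t) 2 (volume.restrict (Ioo 0 1)) := by
  have h1 := memLp_mul_continuousOn (h.memLp ht) (hE.continuousOn_derivWithin ht)
  have h2 := memLp_mul_continuousOn (h.memLp_deriv ht) (hE.continuousOn_apply ht)
  refine (h1.add h2).ae_eq (Eventually.of_forall fun x => ?_)
  simp only [Pi.add_apply, driftDeriv]; ring

/-- Since `E` vanishes at both ends, `E e` has equal end values for any smooth `e`. It is only `C¹`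
up to the boundary, hence the need for `integral_periodic_C1`. -/
theorem integral_drift_mul_deriv (h : IsPeriodicFlow E s sx) (hE : FieldAssumption Cs CE E) {t : ℝ}
    (ht : 0 ≤ t) {e : ℝ → ℝ} (he : ContDiff ℝ ∞ e) :
    ∫ x in Ioo (0 : ℝ) 1, E t x * s t x * deriv e x
      = - ∫ x in Ioo (0 : ℝ) 1, driftDeriv E s sx t x * e x := by
  have hc := hE.continuousOn_apply ht
  have hc' := hE.continuousOn_derivWithin ht
  have hec := he.continuous.continuousOn (s := Icc (0 : ℝ) 1)
  have hec' := (he.continuous_deriv (by simp)).continuousOn (s := Icc (0 : ℝ) 1)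
  have key := integral_periodic_C1 (u := fun x => E t x * e x)
    (u' := fun x => derivWithin (E t) (Icc 0 1) x * e x + E t x * deriv e x)
    (h.memLp ht) (h.memLp_deriv ht) (h.periodic t ht)
    (fun x hx => (hE.hasDerivWithinAt ht hx).mul
      (he.differentiable (by simp) x).hasDerivAt.hasDerivWithinAt)
    ((hc'.mul hec).add (hc.mul hec')) (by rw [hE.left t ht, hE.right t ht, zero_mul, zero_mul])
  have j1 : Integrable (fun x => s t x * (derivWithin (E t) (Icc 0 1) x * e x))
      (volume.restrict (Ioo 0 1)) :=
    (memLp_mul_continuousOn (h.memLp ht) (hc'.mul hec)).integrable one_le_two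
  have j2 : Integrable (fun x => s t x * (E t x * deriv e x)) (volume.restrict (Ioo 0 1)) :=
    (memLp_mul_continuousOn (h.memLp ht) (hc.mul hec')).integrable one_le_two
  have j3 : Integrable (fun x => sx t x * (E t x * e x)) (volume.restrict (Ioo 0 1)) :=
    (memLp_mul_continuousOn (h.memLp_deriv ht) (hc.mul hec)).integrable one_le_two
  have e1 : ∫ x in Ioo (0 : ℝ) 1, s t x *
      (derivWithin (E t) (Icc 0 1) x * e x + E t x * deriv e x)
      = (∫ x in Ioo (0 : ℝ) 1, s t x * (derivWithin (E t) (Icc 0 1) x * e x))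
        + ∫ x in Ioo (0 : ℝ) 1, s t x * (E t x * deriv e x) := by
    rw [← integral_add j1 j2]
    congr 1; ext x; ring
  have e2 : ∫ x in Ioo (0 : ℝ) 1, driftDeriv E s sx t x * e x
      = (∫ x in Ioo (0 : ℝ) 1, s t x * (derivWithin (E t) (Icc 0 1) x * e x))
        + ∫ x in Ioo (0 : ℝ) 1, sx t x * (E t x * e x) := by
    rw [← integral_add j1 j3]
    congr 1; ext x; simp only [driftDeriv]; ring
  have e3 : ∫ x in Ioo (0 : ℝ) 1, E t x * s t x * deriv e x
      = ∫ x in Ioo (0 : ℝ) 1, s t x * (E t x * deriv e x) := by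
    congr 1; ext x; ring
  rw [e2, e3]
  linarith

/-- The evolution of the moment of `s` against an eigenfunction of the periodic Laplacian. -/
theorem hasDerivAt_moment (h : IsPeriodicFlow E s sx) (hE : FieldAssumption Cs CE E)
    {e : ℝ → ℝ} {w : ℝ} (he : ContDiff ℝ ∞ e) (hper : e 0 = e 1)
    (hper' : deriv e 0 = deriv e 1) (heig : ∀ x, deriv (deriv e) x = -w * e x)
    {t : ℝ} (ht : 0 < t) :
    HasDerivAt (fun t => ∫ x in Ioo (0 : ℝ) 1, s t x * e x)
      (-w * (∫ x in Ioo (0 : ℝ) 1, s t x * e x)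
        + ∫ x in Ioo (0 : ℝ) 1, driftDeriv E s sx t x * e x) t := by
  have he' : ContDiff ℝ ∞ (deriv e) := (contDiff_infty_iff_deriv.1 he).2
  convert h.hasDerivAt_integral_mul hE he hper ht using 1
  have hec' := he'.continuous.continuousOn (s := Icc (0 : ℝ) 1)
  have j1 := (memLp_mul_continuousOn (h.memLp_deriv ht.le) hec').integrable one_le_two
  have j2 := (memLp_mul_continuousOn (h.memLp_drift hE ht.le) hec').integrable one_le_two
  have e1 : ∫ x in Ioo (0 : ℝ) 1, (sx t x + E t x * s t x) * deriv e x
      = (∫ x in Ioo (0 : ℝ) 1, sx t x * deriv e x)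
        + ∫ x in Ioo (0 : ℝ) 1, E t x * s t x * deriv e x := by
    rw [← integral_add j1 j2]
    congr 1; ext x; ring
  have e2 : ∫ x in Ioo (0 : ℝ) 1, s t x * deriv (deriv e) x
      = -w * ∫ x in Ioo (0 : ℝ) 1, s t x * e x := by
    rw [← integral_const_mul]
    congr 1; ext x; rw [heig]; ring
  rw [e1, h.periodic t ht.le _ he' hper', e2, h.integral_drift_mul_deriv hE ht.le he]
  ring

theorem hasDerivAt_cosCoeff (h : IsPeriodicFlow E s sx) (hE : FieldAssumption Cs CE E) (k : ℤ)
    {t : ℝ} (ht : 0 < t) :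
    HasDerivAt (fun t => cosCoeff (s t) k)
      (-freq k ^ 2 * cosCoeff (s t) k + cosCoeff (driftDeriv E s sx t) k) t := by
  refine h.hasDerivAt_moment hE (contDiff_cos_freq k) (by simp [cos_freq])
    (by simp [deriv_cos_freq, sin_freq]) (fun x => ?_) ht
  rw [deriv_cos_freq, deriv_const_mul _ ((contDiff_sin_freq k).differentiable (by simp) x),
    deriv_sin_freq]
  ring

theorem hasDerivAt_sinCoeff (h : IsPeriodicFlow E s sx) (hE : FieldAssumption Cs CE E) (k : ℤ)
    {t : ℝ} (ht : 0 < t) :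
    HasDerivAt (fun t => sinCoeff (s t) k)
      (-freq k ^ 2 * sinCoeff (s t) k + sinCoeff (driftDeriv E s sx t) k) t := by
  refine h.hasDerivAt_moment hE (contDiff_sin_freq k) (by simp [sin_freq])
    (by simp [deriv_sin_freq, cos_freq]) (fun x => ?_) ht
  rw [deriv_sin_freq, deriv_const_mul _ ((contDiff_cos_freq k).differentiable (by simp) x),
    deriv_cos_freq]
  ring

/-- Conservation of mass: the test function `1` has zero derivative, so the flux term drops out.
Continuity at `t = 0` links to the initial mass. -/
theorem integral_eq_zero (h : IsPeriodicFlow E s sx) (hE : FieldAssumption Cs CE E) {t : ℝ}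
    (ht : 0 ≤ t) : ∫ x in Ioo (0 : ℝ) 1, s t x = 0 := by
  rcases ht.eq_or_lt with rfl | ht
  · exact h.mass
  have hd : ∀ r, 0 < r → HasDerivAt (fun t => ∫ x in Ioo (0 : ℝ) 1, s t x) 0 r := fun r hr => by
    simpa using h.hasDerivAt_integral_mul hE (e := fun _ => 1) contDiff_const rfl hr
  have hc : ContinuousOn (fun t => ∫ x in Ioo (0 : ℝ) 1, s t x) (Ici 0) := by
    simpa using h.continuousOn_integral_mul (e := fun _ => 1) continuous_const
  obtain ⟨r, hr, hr'⟩ := exists_hasDerivAt_eq_slope (fun t => ∫ x in Ioo (0 : ℝ) 1, s t x)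
    (fun _ => 0) ht (hc.mono Icc_subset_Ici_self) (fun r hr => hd r hr.1)
  rw [eq_comm, div_eq_zero_iff] at hr'
  rcases hr' with h1 | h1
  · rw [h.mass, sub_zero] at h1; exact h1
  · linarith

end IsPeriodicFlow

/-! ### Damping of the Fourier modes and exponential decay -/

/-- Of the dissipation `2 w A²`, the part `36 A²` is kept and `w A²` absorbs the cross term by
Young's inequality, as `w ≥ (1 + w) / 2`. The factor `1 / (1 + w)` left on `b²` cancels the weight:
diffusion gains the derivative that allows an `L²` forcing in an `H¹` estimate. The alternative `A =
0` serves the zero mode. -/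
theorem weighted_damping_le {w A b : ℝ} (h : 36 ≤ w ∨ A = 0) :
    (1 + w) * (2 * A * (-w * A + b)) ≤ -36 * ((1 + w) * A ^ 2) + 2 * b ^ 2 := by
  rcases h with h | rfl
  · have hw : 0 < w := by linarith
    have h2 : 2 * A * b ≤ (w - 36) * A ^ 2 + w * A ^ 2 + b ^ 2 * (2 / (1 + w)) := by
      have e : (w - 36) * A ^ 2 + w * A ^ 2 + b ^ 2 * (2 / (1 + w)) - 2 * A * b
          = (w - 36) * A ^ 2 + (w - (1 + w) / 2) * A ^ 2
            + ((1 + w) * A - 2 * b) ^ 2 / (2 * (1 + w)) := by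
        field_simp; ring
      have e1 : 0 ≤ (w - 36) * A ^ 2 := mul_nonneg (by linarith) (sq_nonneg _)
      have e2 : 0 ≤ (w - (1 + w) / 2) * A ^ 2 := mul_nonneg (by linarith) (sq_nonneg _)
      have e3 : 0 ≤ ((1 + w) * A - 2 * b) ^ 2 / (2 * (1 + w)) := by positivity
      linarith
    have h3 := mul_le_mul_of_nonneg_left h2 (by linarith : 0 ≤ 1 + w)
    have h4 : (1 + w) * (b ^ 2 * (2 / (1 + w))) = 2 * b ^ 2 := by field_simp
    nlinarith
  · simp; positivity

namespace IsPeriodicFlow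

variable {Cs CE : ℝ} {E s sx : ℝ → ℝ → ℝ}

/-- The squared `H¹` norm of `s t`, as a real number. -/
noncomputable def normSq (s sx : ℝ → ℝ → ℝ) (t : ℝ) : ℝ :=
  (∫ x in Ioo (0 : ℝ) 1, s t x ^ 2) + ∫ x in Ioo (0 : ℝ) 1, sx t x ^ 2

theorem normSq_nonneg (t : ℝ) : 0 ≤ normSq s sx t := by unfold normSq; positivity

theorem integral_sq_le {r q : ℝ → ℝ} (hr : MemLp r 2 (volume.restrict (Ioo 0 1)))
    (hq : MemLp q 2 (volume.restrict (Ioo 0 1))) :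
    ∫ x in Ioo (0 : ℝ) 1, r x ^ 2
      ≤ 2 * (∫ x in Ioo (0 : ℝ) 1, (r x - q x) ^ 2) + 2 * ∫ x in Ioo (0 : ℝ) 1, q x ^ 2 := by
  have hd : MemLp (fun x => r x - q x) 2 (volume.restrict (Ioo 0 1)) := hr.sub hq
  rw [← integral_const_mul, ← integral_const_mul,
    ← integral_add (hd.integrable_sq.const_mul 2) (hq.integrable_sq.const_mul 2)]
  refine integral_mono hr.integrable_sq
    ((hd.integrable_sq.const_mul 2).add (hq.integrable_sq.const_mul 2)) fun x => ?_
  have := sq_nonneg (r x - 2 * q x)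
  simp only
  nlinarith

/-- Continuity in `H¹` gives a bound near each time, and compactness a uniform one. It makes the
supremum in `normSq_decay` finite. -/
theorem exists_normSq_le (h : IsPeriodicFlow E s sx) (T : ℝ) :
    ∃ B, ∀ t ∈ Icc 0 T, normSq s sx t ≤ B := by
  refine isCompact_Icc.induction_on (p := fun S => ∃ B, ∀ t ∈ S, 0 ≤ t → normSq s sx t ≤ B)
    ⟨0, by simp⟩ (fun S S' hSS' ⟨B, hB⟩ => ⟨B, fun t ht => hB t (hSS' ht)⟩)
    (fun S S' ⟨B, hB⟩ ⟨B', hB'⟩ => ⟨max B B', fun t ht h0 => ?_⟩) (fun t₀ ht₀ => ?_) |>.imp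
    fun B hB t ht => hB t ht ht.1
  · exact ht.elim (fun ht => (hB t ht h0).trans (le_max_left _ _))
      fun ht => (hB' t ht h0).trans (le_max_right _ _)
  · have h1 := (h.tendsto_sq_sub ht₀.1).eventually (gt_mem_nhds one_pos)
    have h2 : {t | (∫ x in Ioo (0 : ℝ) 1, (s t x - s t₀ x) ^ 2)
        + (∫ x in Ioo (0 : ℝ) 1, (sx t x - sx t₀ x) ^ 2) < 1} ∈ 𝓝[Icc 0 T] t₀ :=
      nhdsWithin_mono _ Icc_subset_Ici_self h1
    refine ⟨_, h2, 2 + 2 * normSq s sx t₀, fun t ht h0 => ?_⟩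
    have a1 := integral_sq_le (h.memLp h0) (h.memLp ht₀.1)
    have a2 := integral_sq_le (h.memLp_deriv h0) (h.memLp_deriv ht₀.1)
    rw [mem_ofPred_eq] at ht
    unfold normSq
    linarith

/-- Pointwise `(a + b)² ≤ 2a² + 2b²`, with both `E` and `∂ₓE` bounded by `CE / 2`. -/
theorem integral_driftDeriv_sq_le (h : IsPeriodicFlow E s sx) (hE : FieldAssumption Cs CE E)
    {t : ℝ} (ht : 0 ≤ t) :
    ∫ x in Ioo (0 : ℝ) 1, driftDeriv E s sx t x ^ 2 ≤ CE ^ 2 / 2 * normSq s sx t := by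
  have i1 := (h.memLp ht).integrable_sq
  have i2 := (h.memLp_deriv ht).integrable_sq
  rw [normSq, ← integral_add i1 i2, ← integral_const_mul]
  refine integral_mono_ae (h.memLp_driftDeriv hE ht).integrable_sq ((i1.add i2).const_mul _) ?_
  filter_upwards [ae_restrict_mem measurableSet_Ioo] with x hx
  have hx' := Ioo_subset_Icc_self hx
  have b1 := sq_le_sq' (abs_le.1 (hE.abs_derivWithin_le ht hx')).1
    (abs_le.1 (hE.abs_derivWithin_le ht hx')).2
  have b2 := sq_le_sq' (abs_le.1 (hE.bound t ht x hx')).1 (abs_le.1 (hE.bound t ht x hx')).2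
  have c1 := mul_le_mul_of_nonneg_right b1 (sq_nonneg (s t x))
  have c2 := mul_le_mul_of_nonneg_right b2 (sq_nonneg (sx t x))
  have c3 := sq_nonneg (derivWithin (E t) (Icc 0 1) x * s t x - E t x * sx t x)
  simp only [driftDeriv]
  nlinarith

/-- The part of the squared `H¹` norm of `r` carried by the frequencies in `K`. -/
noncomputable def partialNormSq (K : Finset ℤ) (r : ℝ → ℝ) : ℝ :=
  ∑ k ∈ K, ((1 + freq k ^ 2) * cosCoeff r k ^ 2 + (1 + freq k ^ 2) * sinCoeff r k ^ 2)

theorem partialNormSq_le (h : IsPeriodicFlow E s sx) (K : Finset ℤ) {t : ℝ} (ht : 0 ≤ t) :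
    partialNormSq K (s t) ≤ normSq s sx t :=
  sum_le_hasSum K (fun k _ => by positivity)
    (hasSum_parseval_H1 (h.memLp ht) (h.memLp_deriv ht) (h.periodic t ht))

theorem normSq_le_of_partialNormSq_le (h : IsPeriodicFlow E s sx) {t B : ℝ} (ht : 0 ≤ t)
    (hB : ∀ K, partialNormSq K (s t) ≤ B) : normSq s sx t ≤ B :=
  hasSum_le_of_sum_le
    (hasSum_parseval_H1 (h.memLp ht) (h.memLp_deriv ht) (h.periodic t ht)) hB

theorem continuousOn_partialNormSq (h : IsPeriodicFlow E s sx) (K : Finset ℤ) :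
    ContinuousOn (fun t => partialNormSq K (s t)) (Ici 0) := by
  refine continuousOn_finsetSum _ fun k _ => ?_
  exact ((h.continuousOn_integral_mul (contDiff_cos_freq k).continuous).pow 2
    |>.const_mul _).add ((h.continuousOn_integral_mul (contDiff_sin_freq k).continuous).pow 2
    |>.const_mul _)

theorem exists_hasDerivAt_partialNormSq (h : IsPeriodicFlow E s sx) (hE : FieldAssumption Cs CE E)
    (K : Finset ℤ) {t : ℝ} (ht : 0 < t) :
    ∃ D, HasDerivAt (fun t => partialNormSq K (s t)) D t ∧
      D ≤ -36 * partialNormSq K (s t) + CE ^ 2 * normSq s sx t := by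
  refine ⟨_, HasDerivAt.fun_sum fun k _ => (((h.hasDerivAt_cosCoeff hE k ht).pow 2).const_mul
    (1 + freq k ^ 2)).add (((h.hasDerivAt_sinCoeff hE k ht).pow 2).const_mul (1 + freq k ^ 2)), ?_⟩
  have hF := sum_le_hasSum K (fun k _ => by positivity)
    (hasSum_parseval (h.memLp_driftDeriv hE ht.le))
  have hF' := h.integral_driftDeriv_sq_le hE ht.le
  have key : ∀ k ∈ K, (1 + freq k ^ 2) * (2 * cosCoeff (s t) k *
        (-freq k ^ 2 * cosCoeff (s t) k + cosCoeff (driftDeriv E s sx t) k))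
      + (1 + freq k ^ 2) * (2 * sinCoeff (s t) k *
        (-freq k ^ 2 * sinCoeff (s t) k + sinCoeff (driftDeriv E s sx t) k))
      ≤ -36 * ((1 + freq k ^ 2) * cosCoeff (s t) k ^ 2 + (1 + freq k ^ 2) * sinCoeff (s t) k ^ 2)
        + 2 * (cosCoeff (driftDeriv E s sx t) k ^ 2 + sinCoeff (driftDeriv E s sx t) k ^ 2) := by
    intro k _
    -- The zero mode has no damping, but its cosine coefficient is the mass, which vanishes, and its
    -- sine coefficient is trivially zero.
    have hk : (36 ≤ freq k ^ 2 ∨ cosCoeff (s t) k = 0) ∧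
        (36 ≤ freq k ^ 2 ∨ sinCoeff (s t) k = 0) := by
      rcases eq_or_ne k 0 with rfl | hk
      · have := h.integral_eq_zero hE ht.le
        constructor <;> right
        · simpa [cosCoeff, freq] using this
        · simp [sinCoeff, freq]
      · exact ⟨Or.inl (le_freq_sq hk), Or.inl (le_freq_sq hk)⟩
    linarith [weighted_damping_le (b := cosCoeff (driftDeriv E s sx t) k) hk.1,
      weighted_damping_le (b := sinCoeff (driftDeriv E s sx t) k) hk.2]
  have hsum := Finset.sum_le_sum key
  rw [Finset.sum_add_distrib (s := K) (f := fun k => -36 * _), ← Finset.mul_sum,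
    ← Finset.mul_sum] at hsum
  refine (le_of_eq ?_).trans (hsum.trans ?_)
  · refine Finset.sum_congr rfl fun k _ => ?_
    norm_num
  · unfold partialNormSq
    linarith

/-- A weighted bound on the norm improves itself through Duhamel's formula. -/
theorem normSq_le_of_bound (h : IsPeriodicFlow E s sx) (hE : FieldAssumption Cs CE E)
    {ν m T : ℝ} (hν : ν < 36)
    (hm : ∀ t ∈ Icc 0 T, normSq s sx t ≤ m * Real.exp (-ν * t)) :
    ∀ t ∈ Icc 0 T, normSq s sx t
      ≤ (CE ^ 2 * m / (36 - ν) + normSq s sx 0) * Real.exp (-ν * t) := by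
  intro t ht
  have hν' : 0 < 36 - ν := by linarith
  have hm0 : 0 ≤ m := by
    have := (normSq_nonneg (s := s) (sx := sx) 0).trans (hm 0 ⟨le_rfl, ht.1.trans ht.2⟩)
    simpa using this
  set A := CE ^ 2 * m / (36 - ν) with hA
  have hA0 : 0 ≤ A := by positivity
  refine h.normSq_le_of_partialNormSq_le ht.1 fun K => ?_
  -- `A e^{-νt}` is the particular solution of `y' = -36 y + CE² m e^{-νt}`. The excess over it,
  -- multiplied by the integrating factor, is therefore nonincreasing.
  set G : ℝ → ℝ := fun t => Real.exp (36 * t) * (partialNormSq K (s t) - A * Real.exp (-ν * t))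
    with hG
  have hanti : AntitoneOn G (Icc 0 T) := by
    refine antitoneOn_of_deriv_nonpos (convex_Icc _ _) ?_ ?_ ?_
    · exact (by fun_prop : Continuous fun t : ℝ => Real.exp (36 * t)).continuousOn.mul
        (((h.continuousOn_partialNormSq K).mono Icc_subset_Ici_self).sub
          (by fun_prop : Continuous fun t : ℝ => A * Real.exp (-ν * t)).continuousOn)
    all_goals
      intro r hr
      rw [interior_Icc] at hr
      obtain ⟨D, hD, hDle⟩ := h.exists_hasDerivAt_partialNormSq hE K hr.1
      have e1 : HasDerivAt (fun t : ℝ => Real.exp (36 * t)) (Real.exp (36 * r) * 36) r := by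
        simpa using ((hasDerivAt_id r).const_mul 36).exp
      have e2 : HasDerivAt (fun t : ℝ => Real.exp (-ν * t)) (Real.exp (-ν * r) * (-ν)) r := by
        simpa using ((hasDerivAt_id r).const_mul (-ν)).exp
      have hder : HasDerivAt G _ r := e1.mul (hD.sub (e2.const_mul A))
    · exact hder.differentiableAt.differentiableWithinAt
    · rw [hder.deriv]
      have hmr := mul_le_mul_of_nonneg_left (hm r ⟨hr.1.le, hr.2.le⟩) (sq_nonneg CE)
      have hAe : A * (36 - ν) = CE ^ 2 * m := by rw [hA]; field_simp
      have : 36 * (partialNormSq K (s r) - A * Real.exp (-ν * r))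
          + (D - A * (Real.exp (-ν * r) * (-ν))) ≤ 0 := by
        have e3 : A * (36 - ν) * Real.exp (-ν * r) = CE ^ 2 * (m * Real.exp (-ν * r)) := by
          rw [hAe]; ring
        nlinarith
      have := mul_nonpos_of_nonneg_of_nonpos (Real.exp_pos (36 * r)).le this
      linarith
  have h1 := hanti ⟨le_rfl, ht.1.trans ht.2⟩ ht ht.1
  simp only [hG, mul_zero, Real.exp_zero, one_mul, mul_one] at h1
  have h2 := h.partialNormSq_le K le_rfl
  have h3 : partialNormSq K (s t) - A * Real.exp (-ν * t)
      ≤ Real.exp (-(36 * t)) * normSq s sx 0 := by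
    rw [Real.exp_neg, inv_mul_eq_div, le_div_iff₀ (Real.exp_pos _), mul_comm]
    linarith
  have h4 : Real.exp (-(36 * t)) ≤ Real.exp (-ν * t) :=
    Real.exp_le_exp.2 (by nlinarith [ht.1])
  have h5 := mul_le_mul_of_nonneg_right h4 (normSq_nonneg (s := s) (sx := sx) 0)
  linarith

/-- With `S` the supremum of `N(r) e^{νr}` over `[0,t]`, `normSq_le_of_bound` gives `S ≤ S / 35 +
N(0)`, because `CE² ≤ 1` and `36 - ν ≥ 35`. As `S` is finite, `S ≤ (35/34) N(0)`, which is below the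
required `(5/4) N(0)`. -/
theorem normSq_decay (h : IsPeriodicFlow E s sx) (hE : FieldAssumption Cs CE E)
    (hCE : CE ≤ 1) {ν : ℝ} (hν0 : 0 ≤ ν) (hν : ν ≤ 1) {t : ℝ} (ht : 0 ≤ t) :
    normSq s sx t ≤ 5 / 4 * Real.exp (-ν * t) * normSq s sx 0 := by
  set S := (fun r => normSq s sx r * Real.exp (ν * r)) '' Icc 0 t with hS
  obtain ⟨B, hB⟩ := h.exists_normSq_le t
  have hbdd : BddAbove S := by
    refine ⟨B * Real.exp (ν * t), ?_⟩
    rintro _ ⟨r, hr, rfl⟩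
    have hB0 : 0 ≤ B := (normSq_nonneg r).trans (hB r hr)
    exact mul_le_mul (hB r hr) (Real.exp_le_exp.2 (by nlinarith [hr.2])) (Real.exp_pos _).le hB0
  have hne : S.Nonempty := ⟨_, 0, ⟨le_rfl, ht⟩, rfl⟩
  have hexp : ∀ r, Real.exp (-ν * r) * Real.exp (ν * r) = 1 := fun r => by
    rw [← Real.exp_add]; simp
  have hm : ∀ r ∈ Icc 0 t, normSq s sx r ≤ sSup S * Real.exp (-ν * r) := by
    intro r hr
    have h1 := mul_le_mul_of_nonneg_right (le_csSup hbdd ⟨r, hr, rfl⟩) (Real.exp_pos (-ν * r)).le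
    simp only at h1
    rwa [mul_assoc, mul_comm (Real.exp (ν * r)), hexp, mul_one] at h1
  have h2 := h.normSq_le_of_bound hE (by linarith : ν < 36) hm
  have h3 : sSup S ≤ CE ^ 2 * sSup S / (36 - ν) + normSq s sx 0 := by
    refine csSup_le hne ?_
    rintro _ ⟨r, hr, rfl⟩
    have h3 := mul_le_mul_of_nonneg_right (h2 r hr) (Real.exp_pos (ν * r)).le
    rwa [mul_assoc, hexp, mul_one] at h3
  have hS0 : 0 ≤ sSup S := by
    have := le_csSup hbdd ⟨0, ⟨le_rfl, ht⟩, rfl⟩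
    exact (mul_nonneg (normSq_nonneg 0) (Real.exp_pos _).le).trans this
  have h4 : CE ^ 2 * sSup S / (36 - ν) ≤ sSup S / 35 := by
    have h5 : CE ^ 2 ≤ 1 := by nlinarith [hE.nonneg]
    refine div_le_div₀ hS0 (mul_le_of_le_one_left hS0 h5) (by norm_num) (by linarith)
  have h6 : sSup S ≤ 5 / 4 * normSq s sx 0 := by
    linarith [normSq_nonneg (s := s) (sx := sx) 0]
  calc normSq s sx t ≤ sSup S * Real.exp (-ν * t) := hm t ⟨ht, le_rfl⟩
    _ ≤ 5 / 4 * normSq s sx 0 * Real.exp (-ν * t) :=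
      mul_le_mul_of_nonneg_right h6 (Real.exp_pos _).le
    _ = _ := by ring

end IsPeriodicFlow

/-! ### From the limit solution to the flow, and conclusion -/

theorem IsLimitSolution.exists_isPeriodicFlow {Cs CE : ℝ} {E : ℝ → ℝ → ℝ} {f : ℝ → ℝ × ℝ → ℝ}
    (hE : FieldAssumption Cs CE E) (hf : IsLimitSolution !![0, 1; 1, 0] E f)
    (hmass : ∫ p in phase, f 0 p = 0) : ∃ sx, IsPeriodicFlow E (density f) sx := by
  obtain ⟨sx, hw, heq⟩ := hf.macroscopic
  have hfin : ∀ t, 0 ≤ t → energy (density f t) (sx t) < ⊤ := fun t ht =>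
    (hw t ht).energy_lt_top (hf.equilibrium t ht) (hf.continuous.1 t ht)
  refine ⟨sx, hw, hfin, fun t₀ ht₀ => tendsto_energy_sub hf.continuous hw hf.equilibrium ht₀,
    fun t ht e he hper => integral_periodic_test (hw t ht) (hf.equilibrium t ht) (hf.feedback t ht)
      (hfin t ht) he hper, fun e he hper θ h1 h2 h3 => ?_,
    integral_eq_zero_of_mass (hf.equilibrium 0 le_rfl) hmass⟩
  have htest := isTestFunction_tensor h1 h2 h3 he hper
  refine Eq.trans ?_ (heq _ htest)
  refine setIntegral_congr_fun measurableSet_Ioi fun t ht => ?_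
  have ht0 : (0 : ℝ) ≤ t := le_of_lt ht
  have hd := htest.smooth.differentiable (by simp)
  obtain ⟨m1, m2⟩ := (hw t ht0).memLp (hfin t ht0)
  have m3 : MemLp (fun x => sx t x + E t x * density f t x) 2 (volume.restrict (Ioo 0 1)) := by
    have := m2.add (memLp_mul_continuousOn m1 (hE.continuousOn_apply ht0))
    refine this.ae_eq (Eventually.of_forall fun x => ?_)
    simp only [Pi.add_apply]; ring
  have j1 := (memLp_mul_continuousOn m1 he.continuous.continuousOn).integrable one_le_two
  have j2 := (memLp_mul_continuousOn m3
    (he.continuous_deriv (by simp)).continuousOn).integrable one_le_two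
  simp only [fderiv_one_zero_eq_deriv hd, fderiv_zero_one_eq_deriv hd]
  rw [← integral_const_mul, ← integral_const_mul,
    ← integral_sub (j1.const_mul _) (j2.const_mul _)]
  congr 1; ext x
  rw [deriv_mul_const (h1.differentiable (by simp) t),
    deriv_const_mul _ (he.differentiable (by simp) x)]
  ring

end VFP

theorem mainTheorem4 (Cs CE a : ℝ) (E : ℝ → ℝ → ℝ) (f : ℝ → ℝ × ℝ → ℝ)
    (hCs : VFP.IsPoincareConstant Cs)
    (hE : VFP.FieldAssumption Cs CE E)
    (ha₁ : 4 * CE / (3 * Cs - 2 * CE) < a)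
    (ha₂ : a < (VFP.lam - CE) / 4)
    (hf : VFP.IsLimitSolution !![0, 1; 1, 0] E f)
    (hmass : ∫ p in VFP.phase, f 0 p = 0) :
    0 < (a * (3 * Cs - 2 * CE) - 4 * CE) / 8 ∧
    ∀ t : ℝ, 0 ≤ t →
      VFP.vNormSq (fun p => f t p / Real.sqrt (VFP.maxwellian p.2)) ≤
        ENNReal.ofReal
            (5 / 4 * Real.exp (-2 * ((a * (3 * Cs - 2 * CE) - 4 * CE) / 8) * t)) *
          VFP.vNormSq (fun p => f 0 p / Real.sqrt (VFP.maxwellian p.2)) := by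
  obtain ⟨hC0, hC1, -⟩ := hCs
  have hsmall := hE.small
  have hCE0 := hE.nonneg
  rw [VFP.lam] at ha₂ hsmall
  have hden : 0 < 3 * Cs - 2 * CE := by linarith
  have hξ : 0 < a * (3 * Cs - 2 * CE) - 4 * CE := by
    rw [div_lt_iff₀ hden] at ha₁
    linarith
  have ha0 : 0 < a := lt_of_le_of_lt (by positivity) ha₁
  refine ⟨by linarith, fun t ht => ?_⟩
  obtain ⟨sx, hflow⟩ := hf.exists_isPeriodicFlow hE hmass
  -- Here `a < 1/16` and `3 Cs - 2 CE ≤ 3`, so the rate is below `3/64`. Smallness of the field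
  -- likewise gives `CE ≤ 1/32`.
  have hν1 : 2 * ((a * (3 * Cs - 2 * CE) - 4 * CE) / 8) ≤ 1 := by nlinarith
  have hdecay := hflow.normSq_decay hE (by linarith) (by linarith) hν1 ht
  rw [(hflow.weakDeriv t ht).vNormSq_eq_energy (hf.equilibrium t ht),
    (hflow.weakDeriv 0 le_rfl).vNormSq_eq_energy (hf.equilibrium 0 le_rfl),
    VFP.energy_eq_ofReal (hflow.memLp ht) (hflow.memLp_deriv ht),
    VFP.energy_eq_ofReal (hflow.memLp le_rfl) (hflow.memLp_deriv le_rfl),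
    ← ENNReal.ofReal_mul (by positivity), neg_mul 2 _]
  exact ENNReal.ofReal_le_ofReal hdecay
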